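/- Let $K\ge 1$ be an integer constant. There is a polynomial-time algorithm (running time bounded by a polynomial, which may depend on $K$, in the bit length of the input) that does the following. The input consists of a matrix $A\in\mathbb{Q}^{m\times 2}$ and a vector $b\in\mathbb{Q}^m$ ($m$ arbitrary) such that $P=\{x\in\mathbb{R}^2: Ax\le b\}$ is a polygon (bounded, with non-empty interior), a vertex $s\in\mathbb{Q}^2$ of $P$, and a vector $c\in\mathbb{Q}^2$. The output is a $c$-monotone circuit walk in $P$ from $s$ to a $c$-maximal vertex of $P$ whose length is at most $\max\{m/K,\,1\}$ times the minimum length of a $c$-monotone circuit walk in $P$ from $s$ to a $c$-maximal vertex of $P$. Here a circuit of $P$ is a vector $g\in\mathbb{R}^2\setminus\{0\}$ that is orthogonal to some non-zero row of $A$. A circuit walk of length $k$ is a sequence $(x_0,\dots,x_k)$ of points of $P$ such that for each $i=1,\dots,k$ we have $x_i=x_{i-1}+\alpha g$ for some circuit $g$ and some $\alpha>0$, where $\alpha$ is maximal subject to $x_{i-1}+\alpha g\in P$. It is $c$-monotone if $c^{\top}x_0<c^{\top}x_1<\dots<c^{\top}x_k$. A vertex is $c$-maximal if it maximizes $c^\top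 x$ over $P$. -/

import Mathlib

/-! ### Polyhedra, circuits and circuit walks -/

namespace CircuitWalks

/-- The polyhedron `{x ∈ ℝ^d | A x ≤ b}`. -/
def polyhedron {m d : ℕ} (A : Matrix (Fin m) (Fin d) ℝ) (b : Fin m → ℝ) : Set (Fin d → ℝ) :=
  {x | ∀ i, (A.mulVec x) i ≤ b i}

/-- The system `A x ≤ b` in two variables defines a (filled, convex) polygon:
the solution set is bounded and two-dimensional. -/
def IsPolygon {m : ℕ} (A : Matrix (Fin m) (Fin 2) ℝ) (b : Fin m → ℝ) : Prop :=
  Bornology.IsBounded (polyhedron A b) ∧ (interior (polyhedron A b)).Nonempty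

/-- `x` is a vertex (extreme point) of `{x | A x ≤ b}`. -/
def IsVertex {m d : ℕ} (A : Matrix (Fin m) (Fin d) ℝ) (b : Fin m → ℝ) (x : Fin d → ℝ) : Prop :=
  x ∈ (polyhedron A b).extremePoints ℝ

/-- `x` is a vertex of `{x | A x ≤ b}` at which `cᵀ x` is maximal over that set. -/
def IsMaximalVertex {m d : ℕ} (A : Matrix (Fin m) (Fin d) ℝ) (b : Fin m → ℝ) (c : Fin d → ℝ)
    (x : Fin d → ℝ) : Prop :=
  IsVertex A b x ∧ ∀ y ∈ polyhedron A b, c ⬝ᵥ y ≤ c ⬝ᵥ x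

/-- A circuit: a nonzero `g` with `A_I g = 0` for a set `I` of `d - 1` rows such that `A_I` has
rank `d - 1`. -/
def IsCircuit {m d : ℕ} (A : Matrix (Fin m) (Fin d) ℝ) (g : Fin d → ℝ) : Prop :=
  g ≠ 0 ∧ ∃ I : Finset (Fin m), I.card + 1 = d ∧
    (A.submatrix (fun i : I => (i : Fin m)) id).rank + 1 = d ∧
    (A.submatrix (fun i : I => (i : Fin m)) id).mulVec g = 0

/-- `x'` is obtained from `x` by a circuit move: `x' = x + α g` for a circuit `g` and a step
`α > 0` that is maximal subject to feasibility. -/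
def IsCircuitMove {m d : ℕ} (A : Matrix (Fin m) (Fin d) ℝ) (b : Fin m → ℝ)
    (x x' : Fin d → ℝ) : Prop :=
  ∃ g, IsCircuit A g ∧ ∃ α : ℝ, 0 < α ∧
    IsGreatest {β : ℝ | x + β • g ∈ polyhedron A b} α ∧ x' = x + α • g

/-- `(x 0, …, x k)` is a circuit walk of length `k`. -/
def IsCircuitWalk {m d : ℕ} (A : Matrix (Fin m) (Fin d) ℝ) (b : Fin m → ℝ) (k : ℕ)
    (x : Fin (k + 1) → Fin d → ℝ) : Prop :=
  (∀ i, x i ∈ polyhedron A b) ∧ ∀ i : Fin k, IsCircuitMove A b (x i.castSucc) (x i.succ)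

/-- `(x 0, …, x k)` is a `c`-monotone circuit walk of length `k` that starts in `s` and ends in a
`c`-maximal vertex. -/
def IsMonotoneWalkToMax {m d : ℕ} (A : Matrix (Fin m) (Fin d) ℝ) (b : Fin m → ℝ)
    (s c : Fin d → ℝ) (k : ℕ) (x : Fin (k + 1) → Fin d → ℝ) : Prop :=
  IsCircuitWalk A b k x ∧ (∀ i : Fin k, c ⬝ᵥ x i.castSucc < c ⬝ᵥ x i.succ) ∧
    x 0 = s ∧ IsMaximalVertex A b c (x (Fin.last k))

end CircuitWalks

/-! ### The machine model

Programs of a random access machine with structured control, over finitely many integer variables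
and integer arrays, with the logarithmic cost criterion: every integer that is written down, read,
used as an address or produced by an arithmetic operation is charged its bit length. Up to
polynomials this is Turing machine time. -/

namespace RAM

/-- Number of bits (including one for the sign) of an integer. -/
def bits (z : ℤ) : ℕ := z.natAbs.size + 1

/-- Memory contents: integer variables `var 0, var 1, …` and integer arrays `arr 0, arr 1, …`. -/
structure State where
  var : ℕ → ℤ
  arr : ℕ → ℤ → ℤ

/-- Arithmetic expressions; `get a i` reads cell `i` of array `a`; `div` is integer division. -/
inductive Expr where
  | const (z : ℤ)
  | var (x : ℕ)
  | get (a : ℕ) (i : Expr)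
  | add (e f : Expr)
  | sub (e f : Expr)
  | mul (e f : Expr)
  | div (e f : Expr)

/-- The value of an expression. -/
def Expr.eval (σ : State) : Expr → ℤ
  | .const z => z
  | .var x => σ.var x
  | .get a i => σ.arr a (i.eval σ)
  | .add e f => e.eval σ + f.eval σ
  | .sub e f => e.eval σ - f.eval σ
  | .mul e f => e.eval σ * f.eval σ
  | .div e f => e.eval σ / f.eval σ

/-- The cost of evaluating an expression: the total bit length of the values of all its
subexpressions (operands, addresses and results). -/
def Expr.cost (σ : State) : Expr → ℕ
  | .const z => bits z
  | .var x => bits (σ.var x)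
  | .get a i => i.cost σ + bits (σ.arr a (i.eval σ))
  | .add e f => e.cost σ + f.cost σ + bits (e.eval σ + f.eval σ)
  | .sub e f => e.cost σ + f.cost σ + bits (e.eval σ - f.eval σ)
  | .mul e f => e.cost σ + f.cost σ + bits (e.eval σ * f.eval σ)
  | .div e f => e.cost σ + f.cost σ + bits (e.eval σ / f.eval σ)

/-- Programs. The test of `ite` and of `loop` (a while loop) is whether the expression is
positive. -/
inductive Prog where
  | skip
  | assign (x : ℕ) (e : Expr)
  | store (a : ℕ) (i e : Expr)
  | seq (p q : Prog)
  | ite (e : Expr) (p q : Prog)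
  | loop (e : Expr) (p : Prog)

/-- The state after `var x := z`. -/
def State.setVar (σ : State) (x : ℕ) (z : ℤ) : State :=
  { σ with var := Function.update σ.var x z }

/-- The state after `arr a [i] := z`. -/
def State.setArr (σ : State) (a : ℕ) (i z : ℤ) : State :=
  { σ with arr := Function.update σ.arr a (Function.update (σ.arr a) i z) }

/-- `Exec p σ t τ`: started in `σ`, the program `p` halts in `τ` after time exactly `t`. -/
inductive Exec : Prog → State → ℕ → State → Prop
  | skip (σ : State) : Exec .skip σ 1 σ
  | assign (σ : State) (x : ℕ) (e : Expr) :
      Exec (.assign x e) σ (e.cost σ + 1) (σ.setVar x (e.eval σ))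
  | store (σ : State) (a : ℕ) (i e : Expr) :
      Exec (.store a i e) σ (i.cost σ + e.cost σ + 1) (σ.setArr a (i.eval σ) (e.eval σ))
  | seq {p q : Prog} {σ τ υ : State} {t u : ℕ} :
      Exec p σ t τ → Exec q τ u υ → Exec (.seq p q) σ (t + u + 1) υ
  | ite_pos {e : Expr} {p q : Prog} {σ τ : State} {t : ℕ} :
      0 < e.eval σ → Exec p σ t τ → Exec (.ite e p q) σ (e.cost σ + t + 1) τ
  | ite_neg {e : Expr} {p q : Prog} {σ τ : State} {t : ℕ} :
      ¬ 0 < e.eval σ → Exec q σ t τ → Exec (.ite e p q) σ (e.cost σ + t + 1) τ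
  | loop_done {e : Expr} {p : Prog} {σ : State} :
      ¬ 0 < e.eval σ → Exec (.loop e p) σ (e.cost σ + 1) σ
  | loop_step {e : Expr} {p : Prog} {σ τ υ : State} {t u : ℕ} :
      0 < e.eval σ → Exec p σ t τ → Exec (.loop e p) τ u υ →
        Exec (.loop e p) σ (e.cost σ + t + u + 1) υ

/-- The initial state: the input stands in cells `0, 1, …` of array `0`, all else is `0`. -/
def State.ofInput (l : List ℤ) : State where
  var := fun _ => 0
  arr := fun a i => if a = 0 ∧ 0 ≤ i then l.getD i.toNat 0 else 0

/-- Bit length of an input. -/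
def inputSize (l : List ℤ) : ℕ := (l.map bits).sum

end RAM

/-! ### Input and output of the algorithm -/

namespace CircuitWalks

/-- A rational number as its reduced numerator and denominator. -/
def encodeRat (q : ℚ) : List ℤ := [q.num, (q.den : ℤ)]

/-- The input `(m, s, c, (A, b))` as a list of integers, the system row by row. -/
def encodeInput {m : ℕ} (A : Matrix (Fin m) (Fin 2) ℚ) (b : Fin m → ℚ) (s c : Fin 2 → ℚ) :
    List ℤ :=
  [(m : ℤ)] ++ encodeRat (s 0) ++ encodeRat (s 1) ++ encodeRat (c 0) ++ encodeRat (c 1) ++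
    (List.finRange m).flatMap fun i =>
      encodeRat (A i 0) ++ encodeRat (A i 1) ++ encodeRat (b i)

/-- The output convention: variable `0` holds the length `k`, and the cells `4 i, …, 4 i + 3` of
array `1` hold numerator and (positive) denominator of the two coordinates of the point `x i`. -/
def OutputsWalk (σ : RAM.State) (k : ℕ) (x : Fin (k + 1) → Fin 2 → ℝ) : Prop :=
  σ.var 0 = k ∧ ∀ i : Fin (k + 1),
    0 < σ.arr 1 (4 * (i : ℤ) + 1) ∧ 0 < σ.arr 1 (4 * (i : ℤ) + 3) ∧
    x i 0 = (σ.arr 1 (4 * (i : ℤ)) : ℝ) / (σ.arr 1 (4 * (i : ℤ) + 1) : ℝ) ∧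
    x i 1 = (σ.arr 1 (4 * (i : ℤ) + 2) : ℝ) / (σ.arr 1 (4 * (i : ℤ) + 3) : ℝ)

/-- Rational vectors and matrices as real ones. -/
def realVec {n : ℕ} (v : Fin n → ℚ) : Fin n → ℝ := fun i => (v i : ℝ)

/-- See `realVec`. -/
def realMat {m n : ℕ} (A : Matrix (Fin m) (Fin n) ℚ) : Matrix (Fin m) (Fin n) ℝ :=
  A.map fun q => (q : ℝ)

end CircuitWalks

/-! Why the algorithm is correct and fast.

In the plane a circuit is orthogonal to a single row, so a monotone move from a point is determined
by a row `r`: it goes in the direction `g = det(A_r, c) • (-A_r1, A_r0)`, for which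
`cᵀ g = det(A_r, c)²` (`exists_pivot_of_isCircuitMove`, `Pivot.isCircuitMove`). Monotone walks of
length `l` are therefore words of length `l` over the rows, of which there are `m ^ l`.

The algorithm follows all words with numbers below `(m + 1) ^ K` in length-lexicographic order;
these include all words of length at most `K`. A letter whose move is impossible is skipped, which
only makes the walk shorter. So the first word that leads to a maximal vertex yields a shortest
walk (`Setup.runs_searchProg`). If there is none, every walk to a maximal vertex is longer than
`K`, and the algorithm instead follows improving edges. A move along an edge ends at the last
point of that edge, so each row is used at most once (`Pivot.not_pivot_of_le`), and the resulting
walk has length at most `m = (m / K) * K` (`Setup.runs_edgeProg`).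

A vertex is maximal exactly if `c` lies in the cone of two independent tight rows; otherwise one of
its edges is improving. Both follow from `optTest_or_exists_improving_edge`, where the edge is found
by sorting the tight rows by angle.

For the running time, points are kept in homogeneous integer coordinates. A move multiplies their
size by at most `10 U ^ 4`, where `U` bounds the integral coefficients, so along a walk of
polynomial length bit lengths stay polynomial without any cancellation. The logarithmic cost of an
execution is at most the number of elementary steps times a polynomial in the bit length of the
largest number written (`StepExec.exists_exec`), and the steps are counted by a small program logic
(`RAM.Runs`). -/

namespace RAM

/-! ### Time bounds from step counts and magnitudes -/

theorem bits_le_iff {z : ℤ} {n : ℕ} : bits z ≤ n + 1 ↔ z.natAbs < 2 ^ n := by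
  rw [bits, Nat.add_le_add_iff_right, Nat.size_le]

theorem natAbs_lt_two_pow_bits (z : ℤ) : z.natAbs < 2 ^ (bits z - 1) :=
  bits_le_iff.1 (by unfold bits; omega)

theorem one_le_bits (z : ℤ) : 1 ≤ bits z := by unfold bits; omega

theorem bits_le_of_natAbs_le {z w : ℤ} (h : z.natAbs ≤ w.natAbs) : bits z ≤ bits w :=
  Nat.add_le_add_right (Nat.size_le_size h) 1

theorem bits_le_of_natAbs_add {x y z : ℤ} (h : z.natAbs ≤ x.natAbs + y.natAbs) :
    bits z ≤ bits x + bits y := by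
  have hx := natAbs_lt_two_pow_bits x
  have hy := natAbs_lt_two_pow_bits y
  have h1 := one_le_bits x
  have h2 := one_le_bits y
  obtain ⟨a, ha⟩ := Nat.exists_eq_add_of_le h1
  obtain ⟨b, hb⟩ := Nat.exists_eq_add_of_le h2
  rw [ha, Nat.add_sub_cancel_left] at hx
  rw [hb, Nat.add_sub_cancel_left] at hy
  have : bits z ≤ (a + b + 1) + 1 := by
    rw [bits_le_iff]
    have h3 : 2 ^ a ≤ 2 ^ (a + b) := Nat.pow_le_pow_right (by norm_num) (by omega)
    have h4 : 2 ^ b ≤ 2 ^ (a + b) := Nat.pow_le_pow_right (by norm_num) (by omega)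
    rw [pow_succ]
    omega
  omega

theorem bits_mul_le (x y : ℤ) : bits (x * y) ≤ bits x + bits y := by
  have hx := natAbs_lt_two_pow_bits x
  have hy := natAbs_lt_two_pow_bits y
  have h1 := one_le_bits x
  have h2 := one_le_bits y
  obtain ⟨a, ha⟩ := Nat.exists_eq_add_of_le h1
  obtain ⟨b, hb⟩ := Nat.exists_eq_add_of_le h2
  rw [ha, Nat.add_sub_cancel_left] at hx
  rw [hb, Nat.add_sub_cancel_left] at hy
  have : bits (x * y) ≤ (a + b) + 1 := by
    rw [bits_le_iff, Int.natAbs_mul, pow_add]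
    exact Nat.mul_lt_mul'' hx hy
  omega

theorem bits_ediv_le (x y : ℤ) : bits (x / y) ≤ bits x :=
  bits_le_of_natAbs_le (Int.natAbs_ediv_le_natAbs x y)

open Polynomial in
/-- A bound on the bit length of the value of an expression, as a polynomial in a common bound on
the bit lengths of the contents of the memory. -/
noncomputable def Expr.valP : Expr → ℕ[X]
  | .const z => C (bits z)
  | .var _ => X
  | .get _ _ => X
  | .add e f => e.valP + f.valP
  | .sub e f => e.valP + f.valP
  | .mul e f => e.valP + f.valP
  | .div e _ => e.valP

open Polynomial in
/-- The analogous bound on the cost of an expression. -/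
noncomputable def Expr.costP : Expr → ℕ[X]
  | .const z => C (bits z)
  | .var _ => X
  | .get _ i => i.costP + X
  | .add e f => e.costP + f.costP + (e.valP + f.valP)
  | .sub e f => e.costP + f.costP + (e.valP + f.valP)
  | .mul e f => e.costP + f.costP + (e.valP + f.valP)
  | .div e f => e.costP + f.costP + e.valP

/-- A bound on the cost of a single step of a program: the sum over all its expressions. -/
noncomputable def Prog.costP : Prog → Polynomial ℕ
  | .skip => 1
  | .assign _ e => e.costP + 1
  | .store _ i e => i.costP + e.costP + 1
  | .seq p q => p.costP + q.costP + 1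
  | .ite e p q => e.costP + p.costP + q.costP + 1
  | .loop e p => e.costP + p.costP + 1

/-- All memory cells are at most `M` in absolute value. -/
def State.Bounded (M : ℕ) (σ : State) : Prop :=
  (∀ x, (σ.var x).natAbs ≤ M) ∧ ∀ a i, (σ.arr a i).natAbs ≤ M

theorem State.Bounded.setVar {M : ℕ} {σ : State} (h : σ.Bounded M) {z : ℤ} (hz : z.natAbs ≤ M)
    (x : ℕ) : (σ.setVar x z).Bounded M := by
  refine ⟨fun y => ?_, h.2⟩
  simp only [State.setVar, Function.update_apply]
  split_ifs
  exacts [hz, h.1 y]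

theorem State.Bounded.setArr {M : ℕ} {σ : State} (h : σ.Bounded M) {z : ℤ} (hz : z.natAbs ≤ M)
    (a : ℕ) (i : ℤ) : (σ.setArr a i z).Bounded M := by
  refine ⟨h.1, fun b j => ?_⟩
  simp only [State.setArr, Function.update_apply]
  split_ifs with hb
  · subst hb
    simp only [Function.update_apply]
    split_ifs
    exacts [hz, h.2 _ j]
  · exact h.2 b j

theorem bits_le_of_bounded {M : ℕ} {z : ℤ} (h : z.natAbs ≤ M) : bits z ≤ M.size + 1 :=
  Nat.add_le_add_right (Nat.size_le_size h) 1

theorem Expr.bits_eval_le {M : ℕ} {σ : State} (h : σ.Bounded M) (e : Expr) :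
    bits (e.eval σ) ≤ e.valP.eval (M.size + 1) := by
  induction e with
  | const z => simp [Expr.eval, Expr.valP]
  | var x => simpa [Expr.eval, Expr.valP] using bits_le_of_bounded (h.1 x)
  | get a i => simpa [Expr.eval, Expr.valP] using bits_le_of_bounded (h.2 a _)
  | add e f he hf =>
    simp only [Expr.eval, Expr.valP, Polynomial.eval_add]
    exact (bits_le_of_natAbs_add (Int.natAbs_add_le _ _)).trans (add_le_add he hf)
  | sub e f he hf =>
    simp only [Expr.eval, Expr.valP, Polynomial.eval_add]
    exact (bits_le_of_natAbs_add (Int.natAbs_sub_le _ _)).trans (add_le_add he hf)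
  | mul e f he hf =>
    simp only [Expr.eval, Expr.valP, Polynomial.eval_add]
    exact (bits_mul_le _ _).trans (add_le_add he hf)
  | div e f he hf => exact (bits_ediv_le _ _).trans he

theorem Expr.cost_le {M : ℕ} {σ : State} (h : σ.Bounded M) (e : Expr) :
    e.cost σ ≤ e.costP.eval (M.size + 1) := by
  induction e with
  | const z => simp [Expr.cost, Expr.costP]
  | var x => simpa [Expr.cost, Expr.costP] using bits_le_of_bounded (h.1 x)
  | get a i hi =>
    simpa [Expr.cost, Expr.costP] using add_le_add hi (bits_le_of_bounded (h.2 a _))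
  | add e f he hf =>
    simpa [Expr.cost, Expr.costP, Expr.valP, Expr.eval] using
      add_le_add (add_le_add he hf) (Expr.bits_eval_le h (.add e f))
  | sub e f he hf =>
    simpa [Expr.cost, Expr.costP, Expr.valP, Expr.eval] using
      add_le_add (add_le_add he hf) (Expr.bits_eval_le h (.sub e f))
  | mul e f he hf =>
    simpa [Expr.cost, Expr.costP, Expr.valP, Expr.eval] using
      add_le_add (add_le_add he hf) (Expr.bits_eval_le h (.mul e f))
  | div e f he hf =>
    simpa [Expr.cost, Expr.costP, Expr.valP, Expr.eval] using
      add_le_add (add_le_add he hf) (Expr.bits_eval_le h (.div e f))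

/-- Execution with unit cost: `StepExec M p σ n τ` says that `p` leads from `σ` to `τ` in `n`
elementary steps and writes only values of absolute value at most `M`. -/
inductive StepExec (M : ℕ) : Prog → State → ℕ → State → Prop
  | skip (σ : State) : StepExec M .skip σ 1 σ
  | assign (σ : State) (x : ℕ) (e : Expr) : (e.eval σ).natAbs ≤ M →
      StepExec M (.assign x e) σ 1 (σ.setVar x (e.eval σ))
  | store (σ : State) (a : ℕ) (i e : Expr) : (e.eval σ).natAbs ≤ M →
      StepExec M (.store a i e) σ 1 (σ.setArr a (i.eval σ) (e.eval σ))
  | seq {p q : Prog} {σ τ υ : State} {t u : ℕ} :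
      StepExec M p σ t τ → StepExec M q τ u υ → StepExec M (.seq p q) σ (t + u + 1) υ
  | ite_pos {e : Expr} {p q : Prog} {σ τ : State} {t : ℕ} :
      0 < e.eval σ → StepExec M p σ t τ → StepExec M (.ite e p q) σ (t + 1) τ
  | ite_neg {e : Expr} {p q : Prog} {σ τ : State} {t : ℕ} :
      ¬ 0 < e.eval σ → StepExec M q σ t τ → StepExec M (.ite e p q) σ (t + 1) τ
  | loop_done {e : Expr} {p : Prog} {σ : State} :
      ¬ 0 < e.eval σ → StepExec M (.loop e p) σ 1 σ
  | loop_step {e : Expr} {p : Prog} {σ τ υ : State} {t u : ℕ} :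
      0 < e.eval σ → StepExec M p σ t τ → StepExec M (.loop e p) τ u υ →
        StepExec M (.loop e p) σ (t + u + 1) υ

/-- The logarithmic cost of an execution is at most the number of steps times the greatest possible
cost of a single step. -/
theorem StepExec.exists_exec {M : ℕ} {p : Prog} {σ τ : State} {n : ℕ} (h : StepExec M p σ n τ)
    (hσ : σ.Bounded M) :
    τ.Bounded M ∧ ∃ t, t ≤ n * p.costP.eval (M.size + 1) ∧ Exec p σ t τ := by
  induction h with
  | skip σ => exact ⟨hσ, 1, by simp [Prog.costP], .skip σ⟩
  | assign σ x e he =>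
    exact ⟨hσ.setVar he x, _, by simpa [Prog.costP] using e.cost_le hσ, .assign σ x e⟩
  | store σ a i e he =>
    exact ⟨hσ.setArr he a _, _,
      by simpa [Prog.costP] using add_le_add (i.cost_le hσ) (e.cost_le hσ), .store σ a i e⟩
  | seq _ _ h1 h2 =>
    obtain ⟨hτ, t, ht, h1⟩ := h1 hσ
    obtain ⟨hυ, u, hu, h2⟩ := h2 hτ
    refine ⟨hυ, _, ?_, .seq h1 h2⟩
    simp only [Prog.costP, Polynomial.eval_add, Polynomial.eval_one]
    nlinarith
  | @ite_pos e p q σ τ n he _ h =>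
    obtain ⟨hτ, t, ht, h⟩ := h hσ
    refine ⟨hτ, _, ?_, .ite_pos he h⟩
    have := e.cost_le hσ
    simp only [Prog.costP, Polynomial.eval_add, Polynomial.eval_one]
    nlinarith
  | @ite_neg e p q σ τ n he _ h =>
    obtain ⟨hτ, t, ht, h⟩ := h hσ
    refine ⟨hτ, _, ?_, .ite_neg he h⟩
    have := e.cost_le hσ
    simp only [Prog.costP, Polynomial.eval_add, Polynomial.eval_one]
    nlinarith
  | @loop_done e p σ he =>
    refine ⟨hσ, _, ?_, .loop_done he⟩
    have := e.cost_le hσ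
    simp only [Prog.costP, Polynomial.eval_add, Polynomial.eval_one]
    omega
  | @loop_step e p σ τ υ n₁ n₂ he _ _ h1 h2 =>
    obtain ⟨hτ, t, ht, h1⟩ := h1 hσ
    obtain ⟨hυ, u, hu, h2⟩ := h2 hτ
    refine ⟨hυ, _, ?_, .loop_step he h1 h2⟩
    have := e.cost_le hσ
    simp only [Prog.costP, Polynomial.eval_add, Polynomial.eval_one] at hu ⊢
    nlinarith

/-! ### A program logic for step counts -/

/-- Total correctness with a step bound: started in `σ`, the program `p` halts after at most `n`
steps in a state that satisfies `Q`, and writes only values of absolute value at most `M`. -/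
def Runs (M : ℕ) (p : Prog) (σ : State) (n : ℕ) (Q : State → Prop) : Prop :=
  ∃ τ k, k ≤ n ∧ StepExec M p σ k τ ∧ Q τ

namespace Runs

variable {M : ℕ} {p q : Prog} {σ : State} {n n₁ n₂ : ℕ} {Q R : State → Prop} {e : Expr}

theorem mono (h : Runs M p σ n₁ R) (hn : n₁ ≤ n₂) (hQ : ∀ τ, R τ → Q τ) : Runs M p σ n₂ Q := by
  obtain ⟨τ, k, hk, hp, hR⟩ := h
  exact ⟨τ, k, hk.trans hn, hp, hQ τ hR⟩

theorem skip (h : Q σ) : Runs M .skip σ 1 Q := ⟨σ, 1, le_rfl, .skip σ, h⟩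

theorem assign {x : ℕ} (he : (e.eval σ).natAbs ≤ M) (h : Q (σ.setVar x (e.eval σ))) :
    Runs M (.assign x e) σ 1 Q :=
  ⟨_, 1, le_rfl, .assign σ x e he, h⟩

theorem store {a : ℕ} {i : Expr} (he : (e.eval σ).natAbs ≤ M)
    (h : Q (σ.setArr a (i.eval σ) (e.eval σ))) : Runs M (.store a i e) σ 1 Q :=
  ⟨_, 1, le_rfl, .store σ a i e he, h⟩

theorem seq (h : Runs M p σ n₁ fun τ => Runs M q τ n₂ Q) :
    Runs M (.seq p q) σ (n₁ + n₂ + 1) Q := by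
  obtain ⟨τ, k, hk, hp, υ, l, hl, hq, hQ⟩ := h
  exact ⟨υ, k + l + 1, by omega, .seq hp hq, hQ⟩

theorem ite (hp : 0 < e.eval σ → Runs M p σ n Q) (hq : ¬ 0 < e.eval σ → Runs M q σ n Q) :
    Runs M (.ite e p q) σ (n + 1) Q := by
  by_cases he : 0 < e.eval σ
  · obtain ⟨τ, k, hk, h, hQ⟩ := hp he
    exact ⟨τ, k + 1, by omega, .ite_pos he h, hQ⟩
  · obtain ⟨τ, k, hk, h, hQ⟩ := hq he
    exact ⟨τ, k + 1, by omega, .ite_neg he h, hQ⟩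

/-- The rule for loops; `I c` is the invariant when at most `c` more iterations are possible. -/
theorem loop (I : ℕ → State → Prop) {c : ℕ} (hI : I c σ)
    (hbody : ∀ c τ, I c τ → 0 < e.eval τ → ∃ d, d < c ∧ Runs M p τ n (I d))
    (hQ : ∀ c τ, I c τ → ¬ 0 < e.eval τ → Q τ) :
    Runs M (.loop e p) σ (c * (n + 1) + 1) Q := by
  induction c using Nat.strong_induction_on generalizing σ with
  | _ c ih =>
    by_cases he : 0 < e.eval σ
    · obtain ⟨d, hd, τ, k, hk, hp, hτ⟩ := hbody c σ hI he
      obtain ⟨υ, l, hl, hloop, hυ⟩ := ih d hd hτ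
      refine ⟨υ, k + l + 1, ?_, .loop_step he hp hloop, hυ⟩
      have : (d + 1) * (n + 1) ≤ c * (n + 1) := Nat.mul_le_mul_right _ hd
      nlinarith
    · exact ⟨σ, 1, by omega, .loop_done he, hQ c σ hI he⟩

end Runs

/-- `for x = 0, …, e - 1 do p`. -/
def Prog.count (x : ℕ) (e : Expr) (p : Prog) : Prog :=
  .seq (.assign x (.const 0))
    (.loop (.sub e (.var x)) (.seq p (.assign x (.add (.var x) (.const 1)))))

/-- `if e₁ > 0 ∧ … ∧ eₙ > 0 then p`. -/
def Prog.whenAll (l : List Expr) (p : Prog) : Prog :=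
  l.foldr (fun e q => .ite e q .skip) p

namespace Runs

variable {M : ℕ} {p : Prog} {σ : State} {n : ℕ} {Q : State → Prop} {e : Expr}

/-- The rule for counting loops; `I i` is the invariant after `i` iterations, `N` their number. -/
theorem count {x N : ℕ} (I : ℕ → State → Prop) (hN : N ≤ M) (h0 : I 0 (σ.setVar x 0))
    (hI : ∀ i τ, I i τ → τ.var x = i ∧ e.eval τ = N)
    (hbody : ∀ i τ, i < N → I i τ →
      Runs M p τ n fun υ => υ.var x = i ∧ I (i + 1) (υ.setVar x ((i + 1 : ℕ) : ℤ)))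
    (hQ : ∀ τ, I N τ → Q τ) :
    Runs M (.count x e p) σ (N * (n + 3) + 3) Q := by
  have key : Runs M (.loop (.sub e (.var x)) (.seq p (.assign x (.add (.var x) (.const 1)))))
      (σ.setVar x 0) (N * (n + 1 + 1 + 1) + 1) Q := by
    refine loop (fun c τ => ∃ i, i + c = N ∧ I i τ) ⟨0, by omega, h0⟩ ?_ ?_
    · rintro c τ ⟨i, hi, hτ⟩ he
      have h1 := hI i τ hτ
      simp only [Expr.eval, h1] at he
      refine ⟨c - 1, by omega, seq ?_⟩
      refine (hbody i τ (by omega) hτ).mono le_rfl ?_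
      rintro υ ⟨hx, hυ⟩
      have he : (Expr.add (.var x) (.const 1)).eval υ = ((i + 1 : ℕ) : ℤ) := by
        simp [Expr.eval, hx]
      refine assign ?_ ⟨i + 1, by omega, ?_⟩
      · rw [he, Int.natAbs_natCast]; omega
      · rwa [he]
    · rintro c τ ⟨i, hi, hτ⟩ he
      have h1 := hI i τ hτ
      simp only [Expr.eval, h1] at he
      obtain rfl : i = N := by omega
      exact hQ τ hτ
  refine (seq (assign (by simp [Expr.eval]) ?_)).mono (n₁ := 1 + (N * (n + 1 + 1 + 1) + 1) + 1)
    (by nlinarith) fun _ h => h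
  exact key

theorem whenAll {l : List Expr} (hp : (∀ e ∈ l, 0 < e.eval σ) → Runs M p σ n Q) (hn : 1 ≤ n)
    (hq : ¬ (∀ e ∈ l, 0 < e.eval σ) → Q σ) : Runs M (.whenAll l p) σ (n + l.length) Q := by
  induction l with
  | nil => exact hp (by simp)
  | cons e l ih =>
    refine ite (fun he => ih (fun h => hp ?_) fun h => hq ?_) fun he => ?_
    · simpa using ⟨he, h⟩
    · exact fun hall => h fun e' he' => hall e' (by simp [he'])
    · refine (skip (hq fun h => he (h e (by simp)))).mono (Nat.le_add_right_of_le hn)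
        fun _ h => h

end Runs

end RAM

namespace CircuitWalks

/-! ### Monotone circuit moves in the plane -/

/-- The determinant of the matrix with columns `u` and `v`. -/
def det2 (u v : Fin 2 → ℝ) : ℝ := u 0 * v 1 - u 1 * v 0

section Geometry

variable {m : ℕ} {A : Matrix (Fin m) (Fin 2) ℝ} {b : Fin m → ℝ} {c : Fin 2 → ℝ}
  {x x' y y' : Fin 2 → ℝ} {r k : Fin m}

/-- The circuit orthogonal to row `r`, oriented and scaled so that `cᵀ g = det(A_r, c)² ≥ 0`. -/
def dir (A : Matrix (Fin m) (Fin 2) ℝ) (c : Fin 2 → ℝ) (r : Fin m) : Fin 2 → ℝ :=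
  ![-(det2 (A r) c * A r 1), det2 (A r) c * A r 0]

/-- The rate `A_j g` at which the slack of row `j` shrinks in the direction `g = dir A c r`. -/
def rate (A : Matrix (Fin m) (Fin 2) ℝ) (c : Fin 2 → ℝ) (r j : Fin m) : ℝ :=
  det2 (A r) c * det2 (A r) (A j)

/-- The slack of row `j` at the point `x`. -/
def slack (A : Matrix (Fin m) (Fin 2) ℝ) (b : Fin m → ℝ) (j : Fin m) (x : Fin 2 → ℝ) : ℝ :=
  b j - (A j 0 * x 0 + A j 1 * x 1)

theorem dotProduct_fin_two (u v : Fin 2 → ℝ) : u ⬝ᵥ v = u 0 * v 0 + u 1 * v 1 := by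
  simp [dotProduct, Fin.sum_univ_two]

theorem mem_polyhedron_iff : x ∈ polyhedron A b ↔ ∀ j, 0 ≤ slack A b j x := by
  simp only [polyhedron, Set.mem_ofPred_eq, slack, sub_nonneg, Matrix.mulVec, dotProduct_fin_two]

theorem slack_add_smul_dir (j : Fin m) (t : ℝ) :
    slack A b j (x + t • dir A c r) = slack A b j x - t * rate A c r j := by
  simp [slack, dir, rate, det2]; ring

theorem dotProduct_add_smul_dir (t : ℝ) :
    c ⬝ᵥ (x + t • dir A c r) = c ⬝ᵥ x + t * det2 (A r) c ^ 2 := by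
  rw [dotProduct_fin_two, dotProduct_fin_two]
  simp [dir, det2]; ring

theorem rate_self : rate A c r r = 0 := by
  simp only [rate, det2]; ring

theorem isCircuit_iff {g : Fin 2 → ℝ} :
    IsCircuit A g ↔ g ≠ 0 ∧ ∃ i, A i ≠ 0 ∧ A i 0 * g 0 + A i 1 * g 1 = 0 := by
  unfold IsCircuit
  refine and_congr_right fun _ => ⟨?_, ?_⟩
  · rintro ⟨I, hI, hr, hg⟩
    obtain ⟨i, rfl⟩ := Finset.card_eq_one.1 (by omega : I.card = 1)
    refine ⟨i, fun h0 => ?_, ?_⟩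
    · have : A.submatrix (fun j : ({i} : Finset (Fin m)) => (j : Fin m)) id = 0 := by
        ext ⟨j, hj⟩ l
        obtain rfl := Finset.mem_singleton.1 hj
        simpa using congrFun h0 l
      rw [this, Matrix.rank_zero] at hr
      omega
    · have := congrFun hg ⟨i, by simp⟩
      simpa [Matrix.mulVec, dotProduct_fin_two] using this
  · rintro ⟨i, hi, hg⟩
    refine ⟨{i}, by simp, ?_, ?_⟩
    · have h1 := Matrix.rank_le_card_height
        (A.submatrix (fun j : ({i} : Finset (Fin m)) => (j : Fin m)) id)
      have h2 : (A.submatrix (fun j : ({i} : Finset (Fin m)) => (j : Fin m)) id).rank ≠ 0 := by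
        rw [Ne, Matrix.rank_eq_finrank_span_row, Submodule.finrank_eq_zero, Submodule.span_eq_bot]
        exact fun h => hi (h _ ⟨⟨i, by simp⟩, rfl⟩)
      simp at h1
      omega
    · ext ⟨j, hj⟩
      obtain rfl := Finset.mem_singleton.1 hj
      simpa [Matrix.mulVec, dotProduct_fin_two] using hg

theorem exists_pos_mul_le {u v : Fin m → ℝ} (hv : ∀ j, 0 ≤ v j) (h : ∀ j, 0 < u j → 0 < v j) :
    ∃ ε : ℝ, 0 < ε ∧ ∀ j, ε * u j ≤ v j := by
  have : ∀ᶠ ε in nhdsWithin (0 : ℝ) (Set.Ioi 0), ∀ j, ε * u j ≤ v j := by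
    rw [Filter.eventually_all]
    intro j
    by_cases hj : 0 < u j
    · filter_upwards [Ioo_mem_nhdsGT (div_pos (h j hj) hj)] with ε hε
      exact ((lt_div_iff₀ hj).1 hε.2).le
    · filter_upwards [self_mem_nhdsWithin] with ε hε
      exact (mul_nonpos_of_nonneg_of_nonpos (le_of_lt hε) (not_lt.1 hj)).trans (hv j)
  obtain ⟨ε, h1, h2⟩ := (this.and self_mem_nhdsWithin).exists
  exact ⟨ε, h2, h1⟩

/-- The improving circuit move from `x` in the direction orthogonal to row `r` is blocked by
row `k` and leads to `x'`. -/
structure Pivot (A : Matrix (Fin m) (Fin 2) ℝ) (b : Fin m → ℝ) (c : Fin 2 → ℝ) (r k : Fin m)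
    (x x' : Fin 2 → ℝ) : Prop where
  rate_pos : 0 < rate A c r k
  slack_pos : 0 < slack A b k x
  ratio : ∀ j, 0 < rate A c r j → slack A b k x * rate A c r j ≤ slack A b j x * rate A c r k
  eq : x' = x + (slack A b k x / rate A c r k) • dir A c r

namespace Pivot

theorem det_ne_zero (h : Pivot A b c r k x x') : det2 (A r) c ≠ 0 := by
  intro h0
  have := h.rate_pos
  simp [rate, h0] at this

theorem step_pos (h : Pivot A b c r k x x') : 0 < slack A b k x / rate A c r k :=
  div_pos h.slack_pos h.rate_pos

theorem mem (h : Pivot A b c r k x x') (hx : x ∈ polyhedron A b) : x' ∈ polyhedron A b := by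
  rw [mem_polyhedron_iff] at hx ⊢
  intro j
  rw [h.eq, slack_add_smul_dir, sub_nonneg]
  by_cases hj : 0 < rate A c r j
  · rw [div_mul_eq_mul_div, div_le_iff₀ h.rate_pos]
    exact h.ratio j hj
  · exact (mul_nonpos_of_nonneg_of_nonpos h.step_pos.le (not_lt.1 hj)).trans (hx j)

theorem dotProduct_lt (h : Pivot A b c r k x x') : c ⬝ᵥ x < c ⬝ᵥ x' := by
  rw [h.eq, dotProduct_add_smul_dir]
  have := h.det_ne_zero
  have := h.step_pos
  have : 0 < slack A b k x / rate A c r k * det2 (A r) c ^ 2 := by positivity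
  linarith

theorem isCircuitMove (h : Pivot A b c r k x x') (hx : x ∈ polyhedron A b) :
    IsCircuitMove A b x x' := by
  have hdet := h.det_ne_zero
  refine ⟨dir A c r, isCircuit_iff.2 ⟨fun h0 => ?_, r, fun h0 => ?_, ?_⟩, _, h.step_pos,
    ⟨?_, fun β hβ => ?_⟩, h.eq⟩
  · have h1 := h.dotProduct_lt
    rw [h.eq, h0] at h1
    simp at h1
  · simp [det2, h0] at hdet
  · simp [dir]; ring
  · have := h.mem hx
    rwa [h.eq] at this
  · have h1 := mem_polyhedron_iff.1 hβ k
    rw [slack_add_smul_dir] at h1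
    rw [le_div_iff₀ h.rate_pos]
    linarith

theorem unique {k' : Fin m} (h : Pivot A b c r k x x') (h' : Pivot A b c r k' x y') :
    x' = y' := by
  rw [h.eq, h'.eq]
  congr 2
  rw [div_eq_div_iff h.rate_pos.ne' h'.rate_pos.ne']
  exact le_antisymm (h.ratio _ h'.rate_pos) (h'.ratio _ h.rate_pos)

/-- A move along an edge ends in the edge's last point: nothing above that point on the line of the
edge is feasible, so no later move uses the same edge. -/
theorem not_pivot_of_le {k' : Fin m} (h : Pivot A b c r k x x') (hr : slack A b r x = 0)
    (hy : y ∈ polyhedron A b) (hxy : c ⬝ᵥ x' ≤ c ⬝ᵥ y) (hry : slack A b r y = 0) :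
    ¬ Pivot A b c r k' y y' := by
  intro h'
  have hk := mem_polyhedron_iff.1 (h'.mem hy) k
  have hlt := hxy.trans_lt h'.dotProduct_lt
  have hy' : slack A b r y' = 0 := by
    rw [h'.eq, slack_add_smul_dir, hry, rate_self]; simp
  have h2 := h.rate_pos
  have h3 := h.eq
  have hdet := h.det_ne_zero
  have hx'k : slack A b k x' = 0 := by
    rw [h.eq, slack_add_smul_dir, div_mul_cancel₀ _ h2.ne', sub_self]
  have hx'r : slack A b r x' = 0 := by
    rw [h.eq, slack_add_smul_dir, hr, rate_self]; simp
  -- `y' - x'` is orthogonal to `A_r`, so `A_k (y' - x')` and `cᵀ (y' - x')` have the same sign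
  have key : slack A b k y' * det2 (A r) c ^ 2 = - rate A c r k * (c ⬝ᵥ y' - c ⬝ᵥ x') := by
    rw [← sub_zero (slack A b k y'), ← hx'k]
    have e : A r 0 * (y' 0 - x' 0) + A r 1 * (y' 1 - x' 1) = 0 := by
      simp only [slack] at hy' hx'r; linarith
    simp only [slack, rate, det2, dotProduct_fin_two]
    linear_combination (-(A r 0 * c 1 - A r 1 * c 0) * (A k 0 * c 1 - A k 1 * c 0)) * e
  have h4 : 0 ≤ slack A b k y' * det2 (A r) c ^ 2 := by positivity
  have h5 : 0 < rate A c r k * (c ⬝ᵥ y' - c ⬝ᵥ x') := mul_pos h2 (sub_pos.2 hlt)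
  linarith

end Pivot

theorem exists_pivot_of_isCircuitMove (h : IsCircuitMove A b x x') (hc : c ⬝ᵥ x < c ⬝ᵥ x') :
    ∃ r k, Pivot A b c r k x x' := by
  obtain ⟨g, hg, α, hα, ⟨hmem, hmax⟩, rfl⟩ := h
  obtain ⟨hg0, r, hr, hrg⟩ := isCircuit_iff.1 hg
  have hn : 0 < A r 0 ^ 2 + A r 1 ^ 2 := by
    by_contra hn
    apply hr
    have h0 : A r 0 = 0 := by nlinarith [sq_nonneg (A r 0), sq_nonneg (A r 1)]
    have h1 : A r 1 = 0 := by nlinarith [sq_nonneg (A r 0), sq_nonneg (A r 1)]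
    ext i; fin_cases i
    exacts [h0, h1]
  have hcg : 0 < c 0 * g 0 + c 1 * g 1 := by
    simp only [dotProduct_fin_two, Pi.add_apply, Pi.smul_apply, smul_eq_mul] at hc
    by_contra hn
    nlinarith
  -- `g` is a positive multiple `μ` of `dir A c r`
  obtain ⟨l, hl0, hl1⟩ : ∃ l, g 0 = -(l * A r 1) ∧ g 1 = l * A r 0 := by
    refine ⟨(A r 0 * g 1 - A r 1 * g 0) / (A r 0 ^ 2 + A r 1 ^ 2), ?_, ?_⟩ <;> field_simp
    · linear_combination (A r 0) * hrg
    · linear_combination (A r 1) * hrg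
  have hl : 0 < l * det2 (A r) c := by
    rw [hl0, hl1] at hcg; simp only [det2]; linarith
  have hdet : det2 (A r) c ≠ 0 := by rintro h0; simp [h0] at hl
  obtain ⟨μ, hμ, hgμ⟩ : ∃ μ : ℝ, 0 < μ ∧ g = μ • dir A c r := by
    refine ⟨l / det2 (A r) c, ?_, ?_⟩
    · rw [← mul_div_mul_right _ _ hdet]
      exact div_pos hl (mul_self_pos.2 hdet)
    · ext i; fin_cases i
      · simp [dir, hl0]; field_simp
      · simp [dir, hl1]; field_simp
  have hx' := mem_polyhedron_iff.1 hmem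
  -- some row blocks the move, as otherwise the step could be enlarged
  obtain ⟨k, hk, hk0⟩ : ∃ k, 0 < rate A c r k ∧ slack A b k (x + α • g) = 0 := by
    by_contra! hno
    obtain ⟨ε, hε, hstep⟩ := exists_pos_mul_le (u := rate A c r) hx' fun j hj =>
      (hx' j).lt_of_ne' (hno j hj)
    have h1 : α + ε / μ ≤ α := hmax <| by
      refine mem_polyhedron_iff.2 fun j => ?_
      have e : x + (α + ε / μ) • g = (x + α • g) + ε • dir A c r := by
        rw [add_smul, ← add_assoc]
        congr 1
        rw [hgμ, smul_smul, div_mul_cancel₀ _ hμ.ne']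
      rw [e, slack_add_smul_dir]
      linarith [hstep j]
    have := div_pos hε hμ
    linarith
  rw [hgμ, smul_smul] at hx' hk0 ⊢
  rw [slack_add_smul_dir, sub_eq_zero] at hk0
  have hα' : α * μ = slack A b k x / rate A c r k := by rw [hk0]; field_simp
  refine ⟨r, k, hk, ?_, fun j hj => ?_, by rw [hα']⟩
  · rw [hk0]; positivity
  · have := hx' j
    rw [slack_add_smul_dir] at this
    rw [hk0]
    nlinarith

/-! ### Vertices and optimality -/

theorem isVertex_iff : IsVertex A b x ↔ x ∈ polyhedron A b ∧
    ∃ i j, slack A b i x = 0 ∧ slack A b j x = 0 ∧ det2 (A i) (A j) ≠ 0 := by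
  rw [IsVertex, mem_extremePoints]
  refine and_congr_right fun hx => ⟨fun h => ?_, ?_⟩
  · by_contra! hno
    obtain ⟨h1, hh1, hort⟩ : ∃ h : Fin 2 → ℝ, h ≠ 0 ∧
        ∀ j, slack A b j x = 0 → A j 0 * h 0 + A j 1 * h 1 = 0 := by
      by_cases hz : ∀ j, slack A b j x = 0 → A j = 0
      · refine ⟨![1, 0], fun h => by simpa using congrFun h 0, fun j hj => ?_⟩
        simp [hz j hj]
      · push Not at hz
        obtain ⟨i, hi, hi0⟩ := hz
        refine ⟨![-A i 1, A i 0], fun h => hi0 ?_, fun j hj => ?_⟩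
        · ext l; fin_cases l
          · simpa using congrFun h 1
          · simpa using congrFun h 0
        · have := hno i j hi hj
          simp only [det2] at this
          simp; linarith
    have hx' := mem_polyhedron_iff.1 hx
    obtain ⟨ε, hε, hstep⟩ := exists_pos_mul_le (u := fun j => |A j 0 * h1 0 + A j 1 * h1 1|) hx'
      fun j hj => (hx' j).lt_of_ne' fun h0 => by simp [hort j h0] at hj
    have hs : ∀ s : ℝ, |s| ≤ ε → x + s • h1 ∈ polyhedron A b := by
      intro s hs
      refine mem_polyhedron_iff.2 fun j => ?_
      have e : slack A b j (x + s • h1) = slack A b j x - s * (A j 0 * h1 0 + A j 1 * h1 1) := by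
        simp [slack]; ring
      rw [e]
      have h2 := le_abs_self (s * (A j 0 * h1 0 + A j 1 * h1 1))
      rw [abs_mul] at h2
      have h3 := mul_le_mul_of_nonneg_right hs (abs_nonneg (A j 0 * h1 0 + A j 1 * h1 1))
      linarith [hstep j]
    have hεabs : |ε| = ε := abs_of_pos hε
    have := (h _ (hs ε hεabs.le) _ (hs (-ε) (by rw [abs_neg, hεabs])) ?_).1
    · have h4 : ε • h1 = 0 := by simpa using this
      exact (smul_ne_zero hε.ne' hh1) h4
    · refine ⟨1 / 2, 1 / 2, by norm_num, by norm_num, by norm_num, ?_⟩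
      ext l; simp; ring
  · rintro ⟨i, j, hi, hj, hdet⟩ y hy z hz ⟨s, t, hs, ht, hst, hyz⟩
    have hy' := mem_polyhedron_iff.1 hy
    have hz' := mem_polyhedron_iff.1 hz
    have hlin : ∀ l, slack A b l x = s * slack A b l y + t * slack A b l z := by
      intro l
      rw [← hyz]
      simp only [slack, Pi.add_apply, Pi.smul_apply, smul_eq_mul]
      linear_combination (-b l) * hst
    have hzero : ∀ l, slack A b l x = 0 → slack A b l y = 0 ∧ slack A b l z = 0 := by
      intro l hl
      have h1 := hlin l
      have h2 := mul_nonneg hs.le (hy' l)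
      have h3 := mul_nonneg ht.le (hz' l)
      rw [hl] at h1
      have h4 : s * slack A b l y = 0 := by linarith
      have h5 : t * slack A b l z = 0 := by linarith
      exact ⟨(mul_eq_zero.1 h4).resolve_left hs.ne', (mul_eq_zero.1 h5).resolve_left ht.ne'⟩
    have huniq : ∀ w, slack A b i w = 0 → slack A b j w = 0 → w = x := by
      intro w hwi hwj
      simp only [slack] at hwi hwj hi hj
      have e0 : det2 (A i) (A j) * (w 0 - x 0) = 0 := by
        simp only [det2]
        linear_combination A j 1 * (hi - hwi) - A i 1 * (hj - hwj)
      have e1 : det2 (A i) (A j) * (w 1 - x 1) = 0 := by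
        simp only [det2]
        linear_combination A i 0 * (hj - hwj) - A j 0 * (hi - hwi)
      ext l; fin_cases l
      · exact sub_eq_zero.1 ((mul_eq_zero.1 e0).resolve_left hdet)
      · exact sub_eq_zero.1 ((mul_eq_zero.1 e1).resolve_left hdet)
    exact ⟨huniq y (hzero i hi).1 (hzero j hj).1, huniq z (hzero i hi).2 (hzero j hj).2⟩

/-- The optimality criterion evaluated by the algorithm: `c` lies in the cone spanned by two
linearly independent rows that are tight at `x`. -/
def OptTest (A : Matrix (Fin m) (Fin 2) ℝ) (b : Fin m → ℝ) (c x : Fin 2 → ℝ) : Prop :=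
  ∃ i j, slack A b i x = 0 ∧ slack A b j x = 0 ∧ 0 < det2 (A i) (A j) ∧
    0 ≤ det2 (A i) c ∧ det2 (A j) c ≤ 0

theorem OptTest.isMaximalVertex (h : OptTest A b c x) (hx : x ∈ polyhedron A b) :
    IsMaximalVertex A b c x := by
  obtain ⟨i, j, hi, hj, hij, hic, hjc⟩ := h
  refine ⟨isVertex_iff.2 ⟨hx, i, j, hi, hj, hij.ne'⟩, fun y hy => ?_⟩
  have hy' := mem_polyhedron_iff.1 hy
  have e : det2 (A i) (A j) * (c ⬝ᵥ x - c ⬝ᵥ y) =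
      - det2 (A j) c * slack A b i y + det2 (A i) c * slack A b j y := by
    simp only [slack] at hi hj ⊢
    simp only [det2, dotProduct_fin_two]
    linear_combination (-(A j 0 * c 1 - A j 1 * c 0)) * (-hi) - (A i 0 * c 1 - A i 1 * c 0) * hj
  have h1 : 0 ≤ det2 (A i) (A j) * (c ⬝ᵥ x - c ⬝ᵥ y) := by
    rw [e]
    have := mul_nonneg (neg_nonneg.2 hjc) (hy' i)
    have := mul_nonneg hic (hy' j)
    linarith
  have := nonneg_of_mul_nonneg_right h1 hij
  linarith

/-- At a vertex, either the optimality criterion holds or one of the two edges is improving. -/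
theorem optTest_or_exists_improving_edge (h : IsVertex A b x) : OptTest A b c x ∨
    ∃ r, slack A b r x = 0 ∧ det2 (A r) c ≠ 0 ∧ ∀ j, slack A b j x = 0 → rate A c r j ≤ 0 := by
  obtain ⟨-, p, q, hp, hq, hpq⟩ := isVertex_iff.1 h
  rw [or_iff_not_imp_left]
  intro hno
  simp only [OptTest, not_exists, not_and, not_le] at hno
  have hno' : ∀ i j, slack A b i x = 0 → slack A b j x = 0 → 0 ≤ det2 (A i) c → det2 (A j) c ≤ 0 →
      det2 (A i) (A j) ≤ 0 := fun i j hi hj hic hjc =>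
    not_lt.1 fun hij => (hno i j hi hj hij hic).not_ge hjc
  have hanti : ∀ u v, det2 u v = - det2 v u := fun u v => by simp only [det2]; ring
  have hne : ∃ t, slack A b t x = 0 ∧ det2 (A t) c ≠ 0 := by
    by_contra! hz
    rcases lt_or_gt_of_ne hpq with h1 | h1
    · have := hno' q p hq hp (hz q hq).ge (hz p hp).le
      rw [hanti] at this; linarith
    · have := hno' p q hp hq (hz p hp).ge (hz q hq).le
      linarith
  -- Among the rows on one side of `c`, the row closest to `c` spans the edge. The slope
  -- `A_t c / det(A_t, c)` orders the rows on one side by angle.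
  have hslope : ∀ s t, det2 (A s) c * det2 (A t) c * ((A t ⬝ᵥ c) / det2 (A t) c -
      (A s ⬝ᵥ c) / det2 (A s) c) = det2 (A s) (A t) * (c 0 ^ 2 + c 1 ^ 2) ∨
      det2 (A s) c * det2 (A t) c = 0 := by
    intro s t
    rw [or_iff_not_imp_right]
    intro h0
    have hs := left_ne_zero_of_mul h0
    have ht := right_ne_zero_of_mul h0
    field_simp
    simp only [det2, dotProduct_fin_two]; ring
  have hc2 : 0 < c 0 ^ 2 + c 1 ^ 2 := by
    obtain ⟨t, -, ht⟩ := hne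
    by_contra hn
    have h0 : c 0 = 0 := by nlinarith [sq_nonneg (c 0), sq_nonneg (c 1)]
    have h1 : c 1 = 0 := by nlinarith [sq_nonneg (c 0), sq_nonneg (c 1)]
    simp [det2, h0, h1] at ht
  have hsign : ∀ s t, 0 < det2 (A s) c * det2 (A t) c →
      (A t ⬝ᵥ c) / det2 (A t) c ≤ (A s ⬝ᵥ c) / det2 (A s) c → det2 (A s) (A t) ≤ 0 := by
    intro s t hst hle
    rcases hslope s t with h1 | h1
    · by_contra hn
      have := mul_pos (not_le.1 hn) hc2
      nlinarith
    · exact absurd h1 hst.ne'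
  classical
  by_cases hneg : ∃ t, slack A b t x = 0 ∧ det2 (A t) c < 0
  · obtain ⟨t, ht, htc⟩ := hneg
    obtain ⟨r, hr, hmin⟩ := Finset.exists_min_image
      (Finset.univ.filter fun t => slack A b t x = 0 ∧ det2 (A t) c < 0)
      (fun t => (A t ⬝ᵥ c) / det2 (A t) c) ⟨t, by simp [ht, htc]⟩
    simp only [Finset.mem_filter, Finset.mem_univ, true_and] at hr hmin
    refine ⟨r, hr.1, hr.2.ne, fun j hj => mul_nonpos_of_nonpos_of_nonneg hr.2.le ?_⟩
    rw [hanti, neg_nonneg]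
    by_cases hjc : det2 (A j) c < 0
    · exact hsign j r (mul_pos_of_neg_of_neg hjc hr.2) (hmin j ⟨hj, hjc⟩)
    · exact hno' j r hj hr.1 (not_lt.1 hjc) hr.2.le
  · push Not at hneg
    obtain ⟨t, ht, htc⟩ := hne
    obtain ⟨r, hr, hmax⟩ := Finset.exists_max_image
      (Finset.univ.filter fun t => slack A b t x = 0 ∧ 0 < det2 (A t) c)
      (fun t => (A t ⬝ᵥ c) / det2 (A t) c)
      ⟨t, by simpa [ht] using lt_of_le_of_ne (hneg t ht) htc.symm⟩
    simp only [Finset.mem_filter, Finset.mem_univ, true_and] at hr hmax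
    refine ⟨r, hr.1, hr.2.ne', fun j hj => mul_nonpos_of_nonneg_of_nonpos hr.2.le ?_⟩
    by_cases hjc : 0 < det2 (A j) c
    · exact hsign r j (mul_pos hr.2 hjc) (hmax j ⟨hj, hjc⟩)
    · exact hno' r j hr.1 hj hr.2.le (not_lt.1 hjc)

theorem exists_rate_pos (hP : Bornology.IsBounded (polyhedron A b)) (hx : x ∈ polyhedron A b)
    (hr : det2 (A r) c ≠ 0) : ∃ j, 0 < rate A c r j := by
  by_contra! hno
  obtain ⟨R, hR⟩ := hP.exists_norm_le
  have hmem : ∀ t : ℝ, 0 ≤ t → x + t • dir A c r ∈ polyhedron A b := fun t ht =>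
    mem_polyhedron_iff.2 fun j => by
      rw [slack_add_smul_dir]
      have := mem_polyhedron_iff.1 hx j
      have := mul_nonpos_of_nonneg_of_nonpos ht (hno j)
      linarith
  have hub : ∀ y ∈ polyhedron A b, c ⬝ᵥ y ≤ (|c 0| + |c 1|) * R := by
    intro y hy
    have h0 := (norm_le_pi_norm y 0).trans (hR y hy)
    have h1 := (norm_le_pi_norm y 1).trans (hR y hy)
    rw [Real.norm_eq_abs] at h0 h1
    rw [dotProduct_fin_two, add_mul]
    refine add_le_add ?_ ?_
    · exact (le_abs_self _).trans (by rw [abs_mul]; gcongr)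
    · exact (le_abs_self _).trans (by rw [abs_mul]; gcongr)
  have hd : 0 < det2 (A r) c ^ 2 := by positivity
  obtain ⟨n, hn⟩ := exists_nat_gt (((|c 0| + |c 1|) * R - c ⬝ᵥ x) / det2 (A r) c ^ 2)
  have := hub _ (hmem n n.cast_nonneg)
  rw [dotProduct_add_smul_dir] at this
  rw [div_lt_iff₀ hd] at hn
  linarith

theorem exists_edge_pivot_or_isMaximalVertex (hP : Bornology.IsBounded (polyhedron A b))
    (hx : IsVertex A b x) :
    IsMaximalVertex A b c x ∨ ∃ r k x', slack A b r x = 0 ∧ Pivot A b c r k x x' := by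
  have hmem := (isVertex_iff.1 hx).1
  have hmem' := mem_polyhedron_iff.1 hmem
  refine (optTest_or_exists_improving_edge hx).imp (fun h => h.isMaximalVertex hmem) ?_
  rintro ⟨r, hr, hrc, htight⟩
  obtain ⟨j, hj⟩ := exists_rate_pos hP hmem hrc
  classical
  obtain ⟨k, hk, hmin⟩ := Finset.exists_min_image
    (Finset.univ.filter fun t => 0 < rate A c r t)
    (fun t => slack A b t x / rate A c r t) ⟨j, by simpa using hj⟩
  simp only [Finset.mem_filter, Finset.mem_univ, true_and] at hk hmin
  refine ⟨r, k, _, hr, hk, (hmem' k).lt_of_ne' fun h0 => (htight k h0).not_gt hk, ?_, rfl⟩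
  intro j hj
  exact (div_le_div_iff₀ hk hj).1 (hmin j hj)

theorem not_pivot_of_isMaximalVertex (h : IsMaximalVertex A b c x) : ¬ Pivot A b c r k x x' :=
  fun h' => h'.dotProduct_lt.not_ge (h.2 _ (h'.mem h.1.1))

/-- If `x` is maximal, no edge at `x` is improving, so the criterion is also necessary. -/
theorem optTest_iff (hx : x ∈ polyhedron A b) :
    OptTest A b c x ↔ IsMaximalVertex A b c x := by
  refine ⟨fun h => h.isMaximalVertex hx, fun h => ?_⟩
  refine (optTest_or_exists_improving_edge h.1).resolve_right ?_
  rintro ⟨r, -, hrc, htight⟩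
  have hx' := mem_polyhedron_iff.1 hx
  obtain ⟨ε, hε, hstep⟩ := exists_pos_mul_le (u := rate A c r) hx' fun j hj =>
    (hx' j).lt_of_ne' fun h0 => (htight j h0).not_gt hj
  have h1 := h.2 (x + ε • dir A c r) <| mem_polyhedron_iff.2 fun j => by
    rw [slack_add_smul_dir]; linarith [hstep j]
  rw [dotProduct_add_smul_dir] at h1
  have : 0 < ε * det2 (A r) c ^ 2 := by positivity
  linarith

/-- A move along an edge ends in a vertex. -/
theorem Pivot.isVertex (h : Pivot A b c r k x x') (hx : x ∈ polyhedron A b)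
    (hr : slack A b r x = 0) : IsVertex A b x' := by
  refine isVertex_iff.2 ⟨h.mem hx, r, k, ?_, ?_, fun h0 => ?_⟩
  · rw [h.eq, slack_add_smul_dir, hr, rate_self]; simp
  · rw [h.eq, slack_add_smul_dir, div_mul_cancel₀ _ h.rate_pos.ne', sub_self]
  · have := h.rate_pos
    simp [rate, h0] at this

end Geometry

end CircuitWalks

namespace CircuitWalks

section Words

variable {m : ℕ} {A : Matrix (Fin m) (Fin 2) ℝ} {b : Fin m → ℝ} {c : Fin 2 → ℝ}
  {x x' y y' : Fin 2 → ℝ} {r k : Fin m}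

/-! ### Walks as words of rows -/

open Classical in
/-- The end point of the improving circuit move from `x` in the direction given by row number `l`;
the point `x` itself if there is no such move. -/
noncomputable def step (A : Matrix (Fin m) (Fin 2) ℝ) (b : Fin m → ℝ) (c : Fin 2 → ℝ)
    (x : Fin 2 → ℝ) (l : ℕ) : Fin 2 → ℝ :=
  if h : ∃ (x' : Fin 2 → ℝ) (r k : Fin m), (r : ℕ) = l ∧ Pivot A b c r k x x' then h.choose else x

theorem Pivot.step_eq (h : Pivot A b c r k x x') : step A b c x r = x' := by
  have hex : ∃ (x' : Fin 2 → ℝ) (r' k : Fin m), (r' : ℕ) = r ∧ Pivot A b c r' k x x' :=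
    ⟨x', r, k, rfl, h⟩
  rw [step, dif_pos hex]
  obtain ⟨r', k', hr, h'⟩ := hex.choose_spec
  obtain rfl := Fin.ext hr
  exact h'.unique h

theorem step_eq_self (h : ∀ k x', ¬ Pivot A b c r k x x') : step A b c x r = x := by
  rw [step, dif_neg]
  rintro ⟨x', r', k', hr, h'⟩
  obtain rfl := Fin.ext hr
  exact h k' x' h'

/-- A monotone circuit walk is determined by the rows to which its moves are orthogonal. -/
theorem exists_word_of_walk {s : Fin 2 → ℝ} {l : ℕ} {y : Fin (l + 1) → Fin 2 → ℝ}
    (h : IsMonotoneWalkToMax A b s c l y) :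
    ∃ w : List ℕ, w.length = l ∧ (∀ a ∈ w, a < m) ∧
      w.foldl (step A b c) s = y (Fin.last l) := by
  obtain ⟨⟨-, hmove⟩, hmono, h0, -⟩ := h
  have key : ∀ i : Fin (l + 1), ∃ w : List ℕ, w.length = i ∧ (∀ a ∈ w, a < m) ∧
      w.foldl (step A b c) s = y i := by
    intro i
    induction i using Fin.induction with
    | zero => exact ⟨[], by simp, by simp, by simp [h0]⟩
    | succ i ih =>
      obtain ⟨w, hw, hwm, hwy⟩ := ih
      obtain ⟨r, k, hrk⟩ := exists_pivot_of_isCircuitMove (hmove i) (hmono i)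
      refine ⟨w ++ [(r : ℕ)], by simpa using hw, fun a ha => ?_, ?_⟩
      · rcases List.mem_append.1 ha with h | h
        · exact hwm a h
        · rw [List.mem_singleton.1 h]; exact r.2
      · rw [List.foldl_append, hwy]
        exact hrk.step_eq
  exact key (Fin.last l)

/-- The word over the alphabet `{0, …, m - 1}` with number `n` in the length-lexicographic order,
that is, the digits of `n` in bijective numeration with base `m`, shifted by one. -/
def word (m : ℕ) : ℕ → List ℕ
  | 0 => []
  | n + 1 => (n % m) :: word m (n / m)
decreasing_by exact Nat.lt_succ_of_le (Nat.div_le_self n m)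

theorem word_zero (m : ℕ) : word m 0 = [] := by rw [word]

theorem word_succ (m n : ℕ) : word m (n + 1) = (n % m) :: word m (n / m) := by rw [word]

theorem length_word_le (m n : ℕ) : (word m n).length ≤ n := by
  induction n using Nat.strong_induction_on with
  | _ n ih =>
    cases n with
    | zero => simp [word_zero]
    | succ n =>
      rw [word_succ, List.length_cons]
      have h1 := Nat.div_le_self n m
      have h2 := ih (n / m) (by omega)
      omega

theorem length_word_mono (m : ℕ) {n n' : ℕ} (h : n ≤ n') :
    (word m n).length ≤ (word m n').length := by
  induction n using Nat.strong_induction_on generalizing n' with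
  | _ n ih =>
    cases n with
    | zero => simp [word_zero]
    | succ n =>
      obtain ⟨n', rfl⟩ : ∃ k, n' = k + 1 := ⟨n' - 1, by omega⟩
      rw [word_succ, word_succ, List.length_cons, List.length_cons]
      have h1 := Nat.div_le_self n m
      have h2 := ih (n / m) (by omega) (Nat.div_le_div_right (c := m) (by omega : n ≤ n'))
      omega

theorem exists_word_eq {w : List ℕ} (hw : ∀ a ∈ w, a < m) :
    ∃ n, n < (m + 1) ^ w.length ∧ word m n = w := by
  induction w with
  | nil => exact ⟨0, by simp, word_zero m⟩
  | cons a w ih =>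
    obtain ⟨n, hn, hnw⟩ := ih fun a ha => hw a (by simp [ha])
    have ha : a < m := hw a (by simp)
    refine ⟨m * n + a + 1, ?_, ?_⟩
    · rw [List.length_cons, pow_succ]
      nlinarith
    · rw [word_succ, Nat.mul_add_mod, Nat.mod_eq_of_lt ha, Nat.mul_add_div (by omega),
        Nat.div_eq_of_lt ha, Nat.add_zero, hnw]

end Words

/-! ### The integer data -/

/-- The left-hand side of row `i` of the integer system read off from the input array `I`: the
rational row times the product of its three denominators. -/
def rowA (I : ℤ → ℤ) (i : ℤ) : ℤ := I (9 + 6 * i) * I (12 + 6 * i) * I (14 + 6 * i)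

/-- See `rowA`. -/
def rowB (I : ℤ → ℤ) (i : ℤ) : ℤ := I (11 + 6 * i) * I (10 + 6 * i) * I (14 + 6 * i)

/-- The right-hand side of row `i`, scaled as in `rowA`. -/
def rowR (I : ℤ → ℤ) (i : ℤ) : ℤ := I (13 + 6 * i) * I (10 + 6 * i) * I (12 + 6 * i)

/-- The objective times the product of its denominators, first coordinate. -/
def objA (I : ℤ → ℤ) : ℤ := I 5 * I 8

/-- The objective times the product of its denominators, second coordinate. -/
def objB (I : ℤ → ℤ) : ℤ := I 7 * I 6

/-- The integer system as a real matrix. -/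
def intMat (I : ℤ → ℤ) (m : ℕ) : Matrix (Fin m) (Fin 2) ℝ :=
  Matrix.of fun i => ![(rowA I i : ℝ), (rowB I i : ℝ)]

/-- The right-hand side of the integer system. -/
def intRhs (I : ℤ → ℤ) (m : ℕ) : Fin m → ℝ := fun i => rowR I i

/-- The integer objective. -/
def intObj (I : ℤ → ℤ) : Fin 2 → ℝ := ![(objA I : ℝ), (objB I : ℝ)]

/-- `det2` of two rows. -/
def intDet (I : ℤ → ℤ) (i j : ℤ) : ℤ := rowA I i * rowB I j - rowB I i * rowA I j

/-- `det2` of a row and the objective. -/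
def intDetC (I : ℤ → ℤ) (i : ℤ) : ℤ := rowA I i * objB I - rowB I i * objA I

/-- `rate` for the integer system. -/
def intRate (I : ℤ → ℤ) (r j : ℤ) : ℤ := intDetC I r * intDet I r j

/-- `slack`, times `W`, of row `j` at the point with homogeneous coordinates `X, Y, W`. -/
def intSlack (I : ℤ → ℤ) (X Y W j : ℤ) : ℤ := rowR I j * W - (rowA I j * X + rowB I j * Y)

/-- The point number `i` of the walk stored in the array `f`. -/
noncomputable def pt (f : ℤ → ℤ) (i : ℕ) : Fin 2 → ℝ :=
  ![(f (4 * i) : ℝ) / (f (4 * i + 1) : ℝ), (f (4 * i + 2) : ℝ) / (f (4 * i + 3) : ℝ)]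

/-- The slack of row `j` at point `i` of the stored walk, times the denominator. -/
def slackAt (I f : ℤ → ℤ) (i j : ℤ) : ℤ :=
  intSlack I (f (4 * i)) (f (4 * i + 2)) (f (4 * i + 1)) j

theorem det2_intMat {m : ℕ} (I : ℤ → ℤ) (i j : Fin m) :
    det2 (intMat I m i) (intMat I m j) = (intDet I i j : ℝ) := by
  simp [det2, intMat, intDet]

theorem det2_intObj {m : ℕ} (I : ℤ → ℤ) (i : Fin m) :
    det2 (intMat I m i) (intObj I) = (intDetC I i : ℝ) := by
  simp [det2, intMat, intDetC, intObj]

theorem rate_intMat {m : ℕ} (I : ℤ → ℤ) (r j : Fin m) :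
    rate (intMat I m) (intObj I) r j = (intRate I r j : ℝ) := by
  rw [rate, det2_intMat, det2_intObj, intRate, Int.cast_mul]

theorem slack_intMat {m : ℕ} {I f : ℤ → ℤ} {i : ℕ} (h : 0 < f (4 * i + 1))
    (h' : f (4 * i + 3) = f (4 * i + 1)) (j : Fin m) :
    slack (intMat I m) (intRhs I m) j (pt f i) = (slackAt I f i j : ℝ) / f (4 * i + 1) := by
  have : (f (4 * i + 1) : ℝ) ≠ 0 := by exact_mod_cast h.ne'
  simp [slack, intMat, intRhs, pt, slackAt, intSlack, h']
  field_simp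

/-- An instance of the problem, as an input array, together with bounds `U`, `V` for the
coefficients and the starting point, `H` for the lengths of walks and `M` for all values. -/
structure Setup where
  I : ℤ → ℤ
  (m U V H M : ℕ)
  I_zero : I 0 = m
  rowA_le : ∀ i < m, (rowA I i).natAbs ≤ U
  rowB_le : ∀ i < m, (rowB I i).natAbs ≤ U
  rowR_le : ∀ i < m, (rowR I i).natAbs ≤ U
  objA_le : (objA I).natAbs ≤ U
  objB_le : (objB I).natAbs ≤ U
  start_le : (I 1 * I 4).natAbs ≤ V ∧ (I 3 * I 2).natAbs ≤ V ∧ (I 2 * I 4).natAbs ≤ V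
  den_pos : 0 < I 2 ∧ 0 < I 4
  U_pos : 0 < U
  V_pos : 0 < V
  hM : V * (10 * U ^ 4) ^ H ≤ M
  m_lt : m < H
  bounded : Bornology.IsBounded (polyhedron (intMat I m) (intRhs I m))
  vertex : IsVertex (intMat I m) (intRhs I m) ![(I 1 : ℝ) / I 2, (I 3 : ℝ) / I 4]

namespace Setup

/-- The constraint matrix. -/
abbrev A (S : Setup) : Matrix (Fin S.m) (Fin 2) ℝ := intMat S.I S.m
/-- The right-hand side. -/
abbrev b (S : Setup) : Fin S.m → ℝ := intRhs S.I S.m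
/-- The objective. -/
abbrev c (S : Setup) : Fin 2 → ℝ := intObj S.I
/-- The starting vertex. -/
noncomputable abbrev s (S : Setup) : Fin 2 → ℝ :=
  ![(S.I 1 : ℝ) / S.I 2, (S.I 3 : ℝ) / S.I 4]

theorem H_le (S : Setup) : S.H ≤ S.M := by
  refine le_trans ?_ S.hM
  have h1 : 2 ≤ 10 * S.U ^ 4 := by
    have := Nat.one_le_pow 4 S.U S.U_pos
    omega
  calc S.H ≤ 2 ^ S.H := Nat.lt_two_pow_self.le
    _ ≤ (10 * S.U ^ 4) ^ S.H := Nat.pow_le_pow_left h1 _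
    _ ≤ _ := Nat.le_mul_of_pos_left _ S.V_pos

theorem V_le (S : Setup) {k : ℕ} (hk : k ≤ S.H) : S.V * (10 * S.U ^ 4) ^ k ≤ S.M :=
  le_trans (Nat.mul_le_mul_left _ (Nat.pow_le_pow_right (by have := S.U_pos; positivity) hk)) S.hM

/-- The array `f` holds, in the output format, a monotone circuit walk of length `k` from `s`.
The numbers that describe its last point are bounded exponentially in `k`. -/
structure Stored (S : Setup) (f : ℤ → ℤ) (k : ℕ) : Prop where
  den_pos : ∀ i ≤ k, 0 < f (4 * (i : ℤ) + 1)
  den_eq : ∀ i ≤ k, f (4 * (i : ℤ) + 3) = f (4 * (i : ℤ) + 1)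
  mem : ∀ i ≤ k, pt f i ∈ polyhedron S.A S.b
  start : pt f 0 = S.s
  move : ∀ i < k, ∃ r j, Pivot S.A S.b S.c r j (pt f i) (pt f (i + 1))
  small : (f (4 * (k : ℤ))).natAbs ≤ S.V * (10 * S.U ^ 4) ^ k ∧
    (f (4 * (k : ℤ) + 2)).natAbs ≤ S.V * (10 * S.U ^ 4) ^ k ∧
    (f (4 * (k : ℤ) + 1)).natAbs ≤ S.V * (10 * S.U ^ 4) ^ k

variable {S : Setup} {f g : ℤ → ℤ} {k : ℕ}

theorem pt_congr {i : ℕ} (h : ∀ z < 4 * (k : ℤ) + 4, g z = f z) (hi : i ≤ k) :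
    pt g i = pt f i := by
  unfold pt
  rw [h _ (by omega), h _ (by omega), h _ (by omega), h _ (by omega)]

theorem Stored.snoc (hf : S.Stored f k) (h : ∀ z < 4 * (k : ℤ) + 4, g z = f z)
    (hden : g (4 * ((k + 1 : ℕ) : ℤ) + 3) = g (4 * ((k + 1 : ℕ) : ℤ) + 1))
    (hpos : 0 < g (4 * ((k + 1 : ℕ) : ℤ) + 1))
    {r j : Fin S.m} (hp : Pivot S.A S.b S.c r j (pt f k) (pt g (k + 1)))
    (hsmall : (g (4 * ((k + 1 : ℕ) : ℤ))).natAbs ≤ S.V * (10 * S.U ^ 4) ^ (k + 1) ∧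
      (g (4 * ((k + 1 : ℕ) : ℤ) + 2)).natAbs ≤ S.V * (10 * S.U ^ 4) ^ (k + 1) ∧
      (g (4 * ((k + 1 : ℕ) : ℤ) + 1)).natAbs ≤ S.V * (10 * S.U ^ 4) ^ (k + 1)) :
    S.Stored g (k + 1) := by
  have hlt : ∀ i ≤ k + 1, i ≤ k ∨ i = k + 1 := fun i hi => by omega
  refine ⟨fun i hi => ?_, fun i hi => ?_, fun i hi => ?_, ?_, fun i hi => ?_, hsmall⟩
  · rcases hlt i hi with hi | rfl
    · rw [h _ (by omega)]; exact hf.den_pos i hi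
    · exact hpos
  · rcases hlt i hi with hi | rfl
    · rw [h _ (by omega), h _ (by omega)]; exact hf.den_eq i hi
    · exact hden
  · rcases hlt i hi with hi | rfl
    · rw [pt_congr h hi]; exact hf.mem i hi
    · exact hp.mem (hf.mem k le_rfl)
  · rw [pt_congr h (Nat.zero_le k)]; exact hf.start
  · rcases Nat.lt_succ_iff_lt_or_eq.1 hi with hi | rfl
    · rw [pt_congr h hi.le, pt_congr h hi]; exact hf.move i hi
    · rw [pt_congr h le_rfl]; exact ⟨r, j, hp⟩

theorem Stored.slack_eq (hf : S.Stored f k) (j : Fin S.m) :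
    slack S.A S.b j (pt f k) = (slackAt S.I f k j : ℝ) / f (4 * k + 1) :=
  slack_intMat (hf.den_pos k le_rfl) (hf.den_eq k le_rfl) j

theorem Stored.slackAt_nonneg (hf : S.Stored f k) {j : ℕ} (hj : j < S.m) :
    0 ≤ slackAt S.I f k j := by
  have h1 := mem_polyhedron_iff.1 (hf.mem k le_rfl) ⟨j, hj⟩
  rw [hf.slack_eq] at h1
  have h2 : (0 : ℝ) < f (4 * k + 1) := by exact_mod_cast hf.den_pos k le_rfl
  have := mul_nonneg h1 h2.le
  rw [div_mul_cancel₀ _ h2.ne'] at this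
  exact_mod_cast this

theorem Stored.slack_eq_zero_iff (hf : S.Stored f k) (j : Fin S.m) :
    slack S.A S.b j (pt f k) = 0 ↔ slackAt S.I f k j = 0 := by
  rw [hf.slack_eq, div_eq_zero_iff]
  have h2 : (f (4 * k + 1) : ℝ) ≠ 0 := by exact_mod_cast (hf.den_pos k le_rfl).ne'
  simp [h2]

end Setup
end CircuitWalks

namespace RAM

/-! ### The algorithm -/

@[simp] theorem State.var_setVar (σ : State) (x y : ℕ) (z : ℤ) :
    (σ.setVar x z).var y = if y = x then z else σ.var y := Function.update_apply ..

@[simp] theorem State.arr_setVar (σ : State) (x : ℕ) (z : ℤ) : (σ.setVar x z).arr = σ.arr := rfl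

@[simp] theorem State.var_setArr (σ : State) (a : ℕ) (i z : ℤ) :
    (σ.setArr a i z).var = σ.var := rfl

@[simp] theorem State.arr_setArr (σ : State) (a a' : ℕ) (i j z : ℤ) :
    (σ.setArr a i z).arr a' j = if a' = a ∧ j = i then z else σ.arr a' j := by
  simp only [State.setArr, Function.update_apply]
  by_cases h : a' = a
  · subst h; simp [Function.update_apply]
  · simp [h]

end RAM

namespace CircuitWalks

open RAM

/-- Cell `j + 6 * i` of the input array. -/
def inputE (j : ℤ) (i : Expr) : Expr := .get 0 (.add (.const j) (.mul (.const 6) i))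

/-- Evaluates to `rowA`. -/
def rowAE (i : Expr) : Expr := .mul (.mul (inputE 9 i) (inputE 12 i)) (inputE 14 i)

/-- Evaluates to `rowB`. -/
def rowBE (i : Expr) : Expr := .mul (.mul (inputE 11 i) (inputE 10 i)) (inputE 14 i)

/-- Evaluates to `rowR`. -/
def rowRE (i : Expr) : Expr := .mul (.mul (inputE 13 i) (inputE 10 i)) (inputE 12 i)

/-- Evaluates to `objA`. -/
def objAE : Expr := .mul (.get 0 (.const 5)) (.get 0 (.const 8))

/-- Evaluates to `objB`. -/
def objBE : Expr := .mul (.get 0 (.const 7)) (.get 0 (.const 6))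

/-- Evaluates to `intDet`. -/
def detE (i j : Expr) : Expr := .sub (.mul (rowAE i) (rowBE j)) (.mul (rowBE i) (rowAE j))

/-- Evaluates to `intDetC`. -/
def detCE (i : Expr) : Expr := .sub (.mul (rowAE i) objBE) (.mul (rowBE i) objAE)

/-- Evaluates to `intRate`. -/
def rateE (r j : Expr) : Expr := .mul (detCE r) (detE r j)

/-- The address of entry `j` of the current point of the walk, which has the number `var 0`. -/
def addrE (j : ℤ) : Expr := .add (.mul (.const 4) (.var 0)) (.const j)

/-- Evaluates to `slackAt` at the current point. -/
def slackE (j : Expr) : Expr :=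
  .sub (.mul (rowRE j) (.get 1 (addrE 1)))
    (.add (.mul (rowAE j) (.get 1 (addrE 0))) (.mul (rowBE j) (.get 1 (addrE 2))))

/-- Finds a row (`var 2`) that blocks the move in the direction of row `var 6`. -/
def scanProg : Prog :=
  .seq (.assign 2 (.var 6)) (.count 1 (.get 0 (.const 0))
    (.whenAll [rateE (.var 6) (.var 1)] (.ite (rateE (.var 6) (.var 2))
      (.whenAll [.sub (.mul (slackE (.var 2)) (rateE (.var 6) (.var 1)))
        (.mul (slackE (.var 1)) (rateE (.var 6) (.var 2)))] (.assign 2 (.var 1)))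
      (.assign 2 (.var 1)))))

/-- Appends to the walk the point reached by a move that is blocked by row `var 2`. -/
def appendProg : Prog :=
  .seq (.store 1 (addrE 4) (.sub (.mul (.get 1 (addrE 0)) (rateE (.var 6) (.var 2)))
      (.mul (slackE (.var 2)) (.mul (detCE (.var 6)) (rowBE (.var 6))))))
  (.seq (.store 1 (addrE 5) (.mul (.get 1 (addrE 1)) (rateE (.var 6) (.var 2))))
  (.seq (.store 1 (addrE 6) (.add (.mul (.get 1 (addrE 2)) (rateE (.var 6) (.var 2)))
      (.mul (slackE (.var 2)) (.mul (detCE (.var 6)) (rowAE (.var 6))))))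
  (.seq (.store 1 (addrE 7) (.get 1 (addrE 5)))
    (.assign 0 (.add (.var 0) (.const 1))))))

/-- Moves in the direction of row `var 6` if this is possible. -/
def moveProg : Prog :=
  .seq scanProg (.whenAll [rateE (.var 6) (.var 2), slackE (.var 2)] appendProg)

/-- Sets `var 5` to `1` if the current point is a maximal vertex. -/
def testProg : Prog :=
  .count 8 (.get 0 (.const 0)) (.count 9 (.get 0 (.const 0)) (.whenAll
    [.sub (.sub (.const 1) (slackE (.var 8))) (slackE (.var 9)), detE (.var 8) (.var 9),
      .add (detCE (.var 8)) (.const 1), .sub (.const 1) (detCE (.var 9))]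
    (.assign 5 (.const 1))))

/-- Resets the walk to the starting point. -/
def initProg : Prog :=
  .seq (.store 1 (.const 0) (.mul (.get 0 (.const 1)) (.get 0 (.const 4))))
  (.seq (.store 1 (.const 1) (.mul (.get 0 (.const 2)) (.get 0 (.const 4))))
  (.seq (.store 1 (.const 2) (.mul (.get 0 (.const 3)) (.get 0 (.const 2))))
  (.seq (.store 1 (.const 3) (.mul (.get 0 (.const 2)) (.get 0 (.const 4))))
    (.assign 0 (.const 0)))))

/-- Follows the word with number `var 4`, skipping impossible moves. -/
def followProg : Prog :=
  .loop (.var 4)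
    (.seq (.assign 6 (.sub (.sub (.var 4) (.const 1)) (.mul (.get 0 (.const 0))
      (.div (.sub (.var 4) (.const 1)) (.get 0 (.const 0))))))
    (.seq (.assign 4 (.div (.sub (.var 4) (.const 1)) (.get 0 (.const 0)))) moveProg))

/-- Evaluates to `(m + 1) ^ K`. -/
def powE : ℕ → Expr
  | 0 => .const 1
  | K + 1 => .mul (powE K) (.add (.get 0 (.const 0)) (.const 1))

/-- Follows the words in length-lexicographic order until one leads to a maximal vertex. -/
def searchProg (K : ℕ) : Prog :=
  .count 3 (powE K) (.whenAll [.sub (.const 1) (.var 5)]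
    (.seq initProg (.seq (.assign 4 (.var 3)) (.seq followProg testProg))))

/-- Follows improving edges. -/
def edgeProg : Prog :=
  .seq initProg (.count 7 (.add (.get 0 (.const 0)) (.const 1)) (.count 6 (.get 0 (.const 0))
    (.whenAll [.sub (.const 1) (slackE (.var 6))] moveProg)))

/-- The algorithm: exhaustive search over short words, then the edge walk. -/
def mainProg (K : ℕ) : Prog :=
  .seq (searchProg K) (.whenAll [.sub (.const 1) (.var 5)] edgeProg)

section Eval

variable (σ : State) (i j : Expr)

theorem eval_rowAE : (rowAE i).eval σ = rowA (σ.arr 0) (i.eval σ) := rfl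
theorem eval_rowBE : (rowBE i).eval σ = rowB (σ.arr 0) (i.eval σ) := rfl
theorem eval_detE : (detE i j).eval σ = intDet (σ.arr 0) (i.eval σ) (j.eval σ) := rfl
theorem eval_detCE : (detCE i).eval σ = intDetC (σ.arr 0) (i.eval σ) := rfl
theorem eval_rateE : (rateE i j).eval σ = intRate (σ.arr 0) (i.eval σ) (j.eval σ) := rfl
theorem eval_addrE (z : ℤ) : (addrE z).eval σ = 4 * σ.var 0 + z := rfl
theorem eval_slackE : (slackE i).eval σ =
    slackAt (σ.arr 0) (σ.arr 1) (σ.var 0) (i.eval σ) := by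
  have : slackAt (σ.arr 0) (σ.arr 1) (σ.var 0) (i.eval σ) =
    intSlack (σ.arr 0) (σ.arr 1 (4 * σ.var 0 + 0)) (σ.arr 1 (4 * σ.var 0 + 2))
      (σ.arr 1 (4 * σ.var 0 + 1)) (i.eval σ) := by rw [add_zero]; rfl
  rw [this]; rfl

theorem eval_powE (K : ℕ) : (powE K).eval σ = (σ.arr 0 0 + 1) ^ K := by
  induction K with
  | zero => simp [powE, Expr.eval]
  | succ K ih => rw [powE, Expr.eval, ih, pow_succ]; rfl

end Eval

/-! ### Single moves -/

namespace Setup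

variable {S : Setup} {σ : State} {f g : ℤ → ℤ} {k : ℕ}

theorem pivot_iff_int (hf : S.Stored f k) {r j : Fin S.m} {x' : Fin 2 → ℝ} :
    Pivot S.A S.b S.c r j (pt f k) x' ↔ 0 < intRate S.I r j ∧ 0 < slackAt S.I f k j ∧
      (∀ i : Fin S.m, 0 < intRate S.I r i →
        slackAt S.I f k j * intRate S.I r i ≤ slackAt S.I f k i * intRate S.I r j) ∧
      x' = pt f k + ((slackAt S.I f k j : ℝ) / f (4 * k + 1) / intRate S.I r j) •
        dir S.A S.c r := by
  have hW : (0 : ℝ) < f (4 * k + 1) := by exact_mod_cast hf.den_pos k le_rfl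
  have hmul : ∀ (a b c d : ℤ), (a : ℝ) / f (4 * k + 1) * b ≤ c / f (4 * k + 1) * d ↔
      a * b ≤ c * d := by
    intro a b c d
    rw [div_mul_eq_mul_div, div_mul_eq_mul_div, div_le_div_iff_of_pos_right hW]
    exact_mod_cast Iff.rfl
  constructor
  · rintro ⟨h1, h2, h3, h4⟩
    simp only [hf.slack_eq, rate_intMat, hmul, Int.cast_pos, div_pos_iff_of_pos_right hW]
      at h1 h2 h3 h4
    exact ⟨h1, h2, h3, h4⟩
  · rintro ⟨h1, h2, h3, h4⟩
    constructor <;>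
    simp only [hf.slack_eq, rate_intMat, hmul, Int.cast_pos, div_pos_iff_of_pos_right hW]
    exacts [h1, h2, h3, h4]

/-- The state holds the input and a walk of length `k` that ends in `x`. -/
def At (S : Setup) (k : ℕ) (x : Fin 2 → ℝ) (σ : State) : Prop :=
  σ.arr 0 = S.I ∧ σ.var 0 = k ∧ S.Stored (σ.arr 1) k ∧ pt (σ.arr 1) k = x

theorem At.congr {x : Fin 2 → ℝ} {τ : State} (h : S.At k x σ) (ha : τ.arr = σ.arr)
    (hv : τ.var 0 = σ.var 0) : S.At k x τ := by
  simpa only [At, ha, hv] using h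

theorem At.mem {x : Fin 2 → ℝ} (h : S.At k x σ) : x ∈ polyhedron S.A S.b := by
  have := h.2.2.1.mem k le_rfl
  rwa [h.2.2.2] at this

theorem m_le (S : Setup) : S.m ≤ S.M := S.m_lt.le.trans S.H_le

/-- What the scan finds out: `j` blocks the move at least as early as the rows before `n`. -/
def Blocks (S : Setup) (f : ℤ → ℤ) (k r n j : ℕ) : Prop :=
  ∀ i < n, 0 < intRate S.I r i → 0 < intRate S.I r j ∧
    slackAt S.I f k j * intRate S.I r i ≤ slackAt S.I f k i * intRate S.I r j

theorem Blocks.succ {r n j : ℕ} (h : S.Blocks f k r n j)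
    (hn : 0 < intRate S.I r n → 0 < intRate S.I r j ∧
      slackAt S.I f k j * intRate S.I r n ≤ slackAt S.I f k n * intRate S.I r j) :
    S.Blocks f k r (n + 1) j := by
  intro i hi
  rcases Nat.lt_succ_iff_lt_or_eq.1 hi with hi | rfl
  exacts [h i hi, hn]

/-- The invariant of the scan that was started in `σ`, after `i` rows. -/
def ScanInv (S : Setup) (σ : State) (k r i : ℕ) (τ : State) : Prop :=
  τ.arr = σ.arr ∧ τ.var 0 = σ.var 0 ∧ (∀ y, 2 < y → τ.var y = σ.var y) ∧ τ.var 1 = i ∧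
    ∃ j : ℕ, j < S.m ∧ τ.var 2 = j ∧ S.Blocks (σ.arr 1) k r i j

theorem runs_scanProg {x : Fin 2 → ℝ} {r : ℕ} (h : S.At k x σ) (hr : r < S.m)
    (hv : σ.var 6 = r) :
    Runs S.M scanProg σ (S.m * 7 + 5) fun τ => τ.arr = σ.arr ∧ τ.var 0 = σ.var 0 ∧
      (∀ y, 2 < y → τ.var y = σ.var y) ∧
      ∃ j : ℕ, j < S.m ∧ τ.var 2 = j ∧ S.Blocks (σ.arr 1) k r S.m j := by
  obtain ⟨hI, hk, hst, -⟩ := h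
  have hmM := S.m_le
  refine (Runs.seq (n₁ := 1) (n₂ := S.m * 7 + 3)
    (Runs.assign ?_ ?_)).mono (by omega) fun _ h => h
  · simp only [Expr.eval, hv]; omega
  refine (Runs.count (N := S.m) (n := 4) (S.ScanInv σ k r) hmM ?_ ?_ ?_ ?_).mono le_rfl fun _ h => h
  · refine ⟨rfl, by simp, fun y hy => ?_, by simp, r, hr, by simp [Expr.eval, hv], ?_⟩
    · simp only [State.var_setVar]
      rw [if_neg (by omega), if_neg (by omega)]
    · intro i hi; omega
  · rintro i τ ⟨h1, h2, h3, h4, -⟩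
    exact ⟨h4, by simp [Expr.eval, h1, hI, S.I_zero]⟩
  · rintro i τ hi ⟨h1, h2, h3, h4, j, hj, h5, h6⟩
    have h7 : τ.var 6 = r := by rw [h3 6 (by norm_num), hv]
    have e1 : (rateE (.var 6) (.var 1)).eval τ = intRate S.I r i := by
      rw [eval_rateE, h1, hI]; simp only [Expr.eval, h7, h4]
    have e2 : (rateE (.var 6) (.var 2)).eval τ = intRate S.I r j := by
      rw [eval_rateE, h1, hI]; simp only [Expr.eval, h7, h5]
    have e3 : (slackE (.var 1)).eval τ = slackAt S.I (σ.arr 1) k i := by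
      rw [eval_slackE, h1, hI, h2, hk]; simp only [Expr.eval, h4]
    have e4 : (slackE (.var 2)).eval τ = slackAt S.I (σ.arr 1) k j := by
      rw [eval_slackE, h1, hI, h2, hk]; simp only [Expr.eval, h5]
    -- the two possible outcomes of an iteration
    have keep : (0 < intRate S.I r i → 0 < intRate S.I r j ∧
        slackAt S.I (σ.arr 1) k j * intRate S.I r i ≤
          slackAt S.I (σ.arr 1) k i * intRate S.I r j) →
        τ.var 1 = i ∧ S.ScanInv σ k r (i + 1) (τ.setVar 1 ((i + 1 : ℕ) : ℤ)) := by
      intro hnew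
      refine ⟨h4, h1, by simpa using h2, fun y hy => ?_, by simp, j, hj, by simpa using h5,
        h6.succ hnew⟩
      rw [State.var_setVar, if_neg (by omega), h3 y hy]
    have replace : S.Blocks (σ.arr 1) k r (i + 1) i →
        Runs S.M (.assign 2 (.var 1)) τ 1 fun υ =>
          υ.var 1 = i ∧ S.ScanInv σ k r (i + 1) (υ.setVar 1 ((i + 1 : ℕ) : ℤ)) := by
      intro hnew
      refine Runs.assign (by simp only [Expr.eval, h4]; omega) ⟨by simp [h4], h1,
        by simpa using h2, fun y hy => ?_, by simp, i, hi, by simp [Expr.eval, h4], hnew⟩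
      simp only [State.var_setVar]
      rw [if_neg (by omega), if_neg (by omega), h3 y hy]
    refine Runs.whenAll (n := 3) (fun hpos => ?_) (by norm_num) fun hpos => keep fun hpos' => ?_
    · replace hpos : 0 < intRate S.I r i := by simpa [e1] using hpos
      refine Runs.ite (n := 2) (fun hj0 => ?_) fun hj0 => ?_
      · rw [e2] at hj0
        refine Runs.whenAll (n := 1) (fun hlt => replace ?_) le_rfl
          fun hle => keep fun _ => ⟨hj0, ?_⟩
        · simp only [List.mem_singleton, forall_eq, Expr.eval, e1, e2, e3, e4, sub_pos] at hlt
          intro l hl hl0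
          refine ⟨hpos, ?_⟩
          rcases Nat.lt_succ_iff_lt_or_eq.1 hl with hl | rfl
          · have h8 := (h6 l hl hl0).2
            -- `s_i / ρ_i ≤ s_j / ρ_j ≤ s_l / ρ_l`
            refine le_of_mul_le_mul_right (a := intRate S.I r j) ?_ hj0
            nlinarith
          · exact le_rfl
        · simpa only [List.mem_singleton, forall_eq, Expr.eval, e1, e2, e3, e4, sub_pos,
            not_lt] using hle
      · rw [e2] at hj0
        refine (replace ?_).mono (by norm_num) fun _ h => h
        intro l hl hl0
        rcases Nat.lt_succ_iff_lt_or_eq.1 hl with hl | rfl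
        · exact absurd (h6 l hl hl0).1 hj0
        · exact ⟨hpos, le_rfl⟩
    · exact absurd (by simpa [e1] using hpos') hpos
  · rintro τ ⟨h1, h2, h3, h4, j, hj, h5, h6⟩
    exact ⟨h1, h2, h3, j, hj, h5, h6⟩

end Setup
end CircuitWalks

namespace CircuitWalks

open RAM

namespace Setup

variable {S : Setup} {σ : State} {f g : ℤ → ℤ} {k : ℕ}

theorem natAbs_intDet_le {i j : ℕ} (hi : i < S.m) (hj : j < S.m) :
    (intDet S.I i j).natAbs ≤ 2 * S.U ^ 2 := by
  refine (Int.natAbs_sub_le _ _).trans ?_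
  rw [Int.natAbs_mul, Int.natAbs_mul]
  have h1 := Nat.mul_le_mul (S.rowA_le i hi) (S.rowB_le j hj)
  have h2 := Nat.mul_le_mul (S.rowB_le i hi) (S.rowA_le j hj)
  linarith

theorem natAbs_intDetC_le {i : ℕ} (hi : i < S.m) :
    (intDetC S.I i).natAbs ≤ 2 * S.U ^ 2 := by
  refine (Int.natAbs_sub_le _ _).trans ?_
  rw [Int.natAbs_mul, Int.natAbs_mul]
  have h1 := Nat.mul_le_mul (S.rowA_le i hi) S.objB_le
  have h2 := Nat.mul_le_mul (S.rowB_le i hi) S.objA_le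
  linarith

theorem natAbs_intRate_le {i j : ℕ} (hi : i < S.m) (hj : j < S.m) :
    (intRate S.I i j).natAbs ≤ 4 * S.U ^ 4 := by
  rw [intRate, Int.natAbs_mul]
  have h1 := Nat.mul_le_mul (natAbs_intDetC_le hi) (natAbs_intDet_le hi hj)
  linarith

theorem Stored.natAbs_slackAt_le (hf : S.Stored f k) {j : ℕ} (hj : j < S.m) :
    (slackAt S.I f k j).natAbs ≤ 3 * S.U * (S.V * (10 * S.U ^ 4) ^ k) := by
  obtain ⟨hX, hY, hW⟩ := hf.small
  refine (Int.natAbs_sub_le _ _).trans ?_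
  have h0 := Int.natAbs_add_le (rowA S.I j * f (4 * k)) (rowB S.I j * f (4 * k + 2))
  rw [Int.natAbs_mul, Int.natAbs_mul] at h0
  rw [Int.natAbs_mul]
  have h1 := Nat.mul_le_mul (S.rowR_le j hj) hW
  have h2 := Nat.mul_le_mul (S.rowA_le j hj) hX
  have h3 := Nat.mul_le_mul (S.rowB_le j hj) hY
  linarith

/-- The numerators grow by a constant factor with every move. -/
theorem natAbs_coord_le {U V : ℕ} {x ρ w e a : ℤ} (hx : x.natAbs ≤ V) (hρ : ρ.natAbs ≤ 4 * U ^ 4)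
    (hw : w.natAbs ≤ 3 * U * V) (he : e.natAbs ≤ 2 * U ^ 2) (ha : a.natAbs ≤ U) :
    (x * ρ).natAbs + (w * (e * a)).natAbs ≤ V * (10 * U ^ 4) := by
  rw [Int.natAbs_mul, Int.natAbs_mul, Int.natAbs_mul]
  have h1 := Nat.mul_le_mul hx hρ
  have h2 := Nat.mul_le_mul hw (Nat.mul_le_mul he ha)
  linarith

theorem runs_appendProg {x : Fin 2 → ℝ} {r j : ℕ} (h : S.At k x σ) (hr : r < S.m) (hj : j < S.m)
    (hk : k < S.H) (hv : σ.var 6 = r) (hv2 : σ.var 2 = j) (hrate : 0 < intRate S.I r j)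
    (hslack : 0 < slackAt S.I (σ.arr 1) k j)
    (hB : S.Blocks (σ.arr 1) k r S.m j) :
    Runs S.M appendProg σ 9 fun τ => (∀ y, 2 < y → τ.var y = σ.var y) ∧
      ∃ x', Pivot S.A S.b S.c ⟨r, hr⟩ ⟨j, hj⟩ x x' ∧ S.At (k + 1) x' τ := by
  obtain ⟨hI, hk0, hst, rfl⟩ := h
  have hMk := S.V_le (k := k + 1) hk
  rw [pow_succ, ← mul_assoc] at hMk
  obtain ⟨hX, hY, hW⟩ := hst.small
  have hslackle := hst.natAbs_slackAt_le hj
  have hratele := natAbs_intRate_le hr hj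
  have hX' := natAbs_coord_le hX hratele hslackle (natAbs_intDetC_le hr) (S.rowB_le r hr)
  have hY' := natAbs_coord_le hY hratele hslackle (natAbs_intDetC_le hr) (S.rowA_le r hr)
  have hW' := (Nat.le_add_right _ _).trans
    (natAbs_coord_le hW hratele hslackle (natAbs_intDetC_le hr) (S.rowA_le r hr))
  set X' := σ.arr 1 (4 * k) * intRate S.I r j -
    slackAt S.I (σ.arr 1) k j * (intDetC S.I r * rowB S.I r) with hX'def
  set Y' := σ.arr 1 (4 * k + 2) * intRate S.I r j +
    slackAt S.I (σ.arr 1) k j * (intDetC S.I r * rowA S.I r) with hY'def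
  set W' := σ.arr 1 (4 * k + 1) * intRate S.I r j with hW'def
  have hX'' := (Int.natAbs_sub_le (σ.arr 1 (4 * k) * intRate S.I r j)
    (slackAt S.I (σ.arr 1) k j * (intDetC S.I r * rowB S.I r))).trans hX'
  have hY'' := (Int.natAbs_add_le (σ.arr 1 (4 * k + 2) * intRate S.I r j)
    (slackAt S.I (σ.arr 1) k j * (intDetC S.I r * rowA S.I r))).trans hY'
  rw [← hX'def] at hX''
  rw [← hY'def] at hY''
  -- the values that are stored, as long as the current point is intact
  have hval : ∀ τ : State, τ.var = σ.var → τ.arr 0 = S.I →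
      (∀ z < 4 * (k : ℤ) + 4, τ.arr 1 z = σ.arr 1 z) →
      (Expr.sub (.mul (.get 1 (addrE 0)) (rateE (.var 6) (.var 2)))
        (.mul (slackE (.var 2)) (.mul (detCE (.var 6)) (rowBE (.var 6))))).eval τ = X' ∧
      (Expr.mul (.get 1 (addrE 1)) (rateE (.var 6) (.var 2))).eval τ = W' ∧
      (Expr.add (.mul (.get 1 (addrE 2)) (rateE (.var 6) (.var 2)))
        (.mul (slackE (.var 2)) (.mul (detCE (.var 6)) (rowAE (.var 6))))).eval τ = Y' := by
    intro τ h1 h2 h3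
    have e1 : (slackE (.var 2)).eval τ = slackAt S.I (σ.arr 1) k j := by
      rw [eval_slackE, h2, h1, hk0]
      simp only [Expr.eval, h1, hv2, slackAt]
      rw [h3 _ (by omega), h3 _ (by omega), h3 _ (by omega)]
    have e2 : (rateE (.var 6) (.var 2)).eval τ = intRate S.I r j := by
      rw [eval_rateE, h2]; simp only [Expr.eval, h1, hv, hv2]
    have e3 : (detCE (.var 6)).eval τ = intDetC S.I r := by
      rw [eval_detCE, h2]; simp only [Expr.eval, h1, hv]
    have e4 : (rowAE (.var 6)).eval τ = rowA S.I r := by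
      rw [eval_rowAE, h2]; simp only [Expr.eval, h1, hv]
    have e5 : (rowBE (.var 6)).eval τ = rowB S.I r := by
      rw [eval_rowBE, h2]; simp only [Expr.eval, h1, hv]
    simp only [Expr.eval, e1, e2, e3, e4, e5, eval_addrE, h1, hk0, add_zero]
    rw [h3 _ (by omega), h3 _ (by omega), h3 _ (by omega)]
    exact ⟨rfl, rfl, rfl⟩
  have haddr : ∀ (τ : State) (z : ℤ), τ.var = σ.var → (addrE z).eval τ = 4 * k + z := by
    intro τ z h1
    rw [eval_addrE, h1, hk0]
  obtain ⟨v1, -, -⟩ := hval σ rfl hI fun _ _ => rfl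
  refine (Runs.seq (n₁ := 1) (n₂ := 7) (Runs.store (by rw [v1]; omega) ?_))
  rw [v1, haddr σ 4 rfl]
  set σ₁ := σ.setArr 1 (4 * k + 4) X' with hσ₁
  obtain ⟨-, v2, -⟩ := hval σ₁ rfl (by ext z; simp [hσ₁, hI]) fun z hz => by
    simp only [hσ₁, State.arr_setArr]; rw [if_neg (by omega)]
  refine (Runs.seq (n₁ := 1) (n₂ := 5) (Runs.store (by rw [v2]; omega) ?_))
  rw [v2, haddr σ₁ 5 rfl]
  set σ₂ := σ₁.setArr 1 (4 * k + 5) W' with hσ₂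
  obtain ⟨-, -, v3⟩ := hval σ₂ rfl (by ext z; simp [hσ₂, hσ₁, hI]) fun z hz => by
    simp only [hσ₂, hσ₁, State.arr_setArr]; rw [if_neg (by omega), if_neg (by omega)]
  refine (Runs.seq (n₁ := 1) (n₂ := 3) (Runs.store (by rw [v3]; omega) ?_))
  rw [v3, haddr σ₂ 6 rfl]
  set σ₃ := σ₂.setArr 1 (4 * k + 6) Y' with hσ₃
  have v4 : (Expr.get 1 (addrE 5)).eval σ₃ = W' := by
    rw [Expr.eval, haddr σ₃ 5 rfl]
    simp [hσ₃, hσ₂]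
  refine (Runs.seq (n₁ := 1) (n₂ := 1) (Runs.store (by rw [v4]; omega) ?_))
  rw [v4, haddr σ₃ 7 rfl]
  set σ₄ := σ₃.setArr 1 (4 * k + 7) W' with hσ₄
  have hvar : σ₄.var = σ.var := rfl
  have v5 : (Expr.add (.var 0) (.const 1)).eval σ₄ = ((k + 1 : ℕ) : ℤ) := by
    simp [Expr.eval, hvar, hk0]
  refine Runs.assign (by rw [v5]; have := S.H_le; omega) ?_
  rw [v5]
  have hg : ∀ z < 4 * (k : ℤ) + 4, σ₄.arr 1 z = σ.arr 1 z := by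
    intro z hz
    simp only [hσ₄, hσ₃, hσ₂, hσ₁, State.arr_setArr]
    rw [if_neg (by omega), if_neg (by omega), if_neg (by omega), if_neg (by omega)]
  have c0 : σ₄.arr 1 (4 * ((k + 1 : ℕ) : ℤ)) = X' := by
    have : 4 * ((k + 1 : ℕ) : ℤ) = 4 * k + 4 := by push_cast; ring
    rw [this]; simp [hσ₄, hσ₃, hσ₂, hσ₁]
  have c1 : σ₄.arr 1 (4 * ((k + 1 : ℕ) : ℤ) + 1) = W' := by
    have : 4 * ((k + 1 : ℕ) : ℤ) + 1 = 4 * k + 5 := by push_cast; ring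
    rw [this]; simp [hσ₄, hσ₃, hσ₂]
  have c2 : σ₄.arr 1 (4 * ((k + 1 : ℕ) : ℤ) + 2) = Y' := by
    have : 4 * ((k + 1 : ℕ) : ℤ) + 2 = 4 * k + 6 := by push_cast; ring
    rw [this]; simp [hσ₄, hσ₃]
  have c3 : σ₄.arr 1 (4 * ((k + 1 : ℕ) : ℤ) + 3) = W' := by
    have : 4 * ((k + 1 : ℕ) : ℤ) + 3 = 4 * k + 7 := by push_cast; ring
    rw [this]; simp [hσ₄]
  have hpt : pt (σ₄.arr 1) (k + 1) = pt (σ.arr 1) k +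
      ((slackAt S.I (σ.arr 1) k (⟨j, hj⟩ : Fin S.m) : ℝ) / σ.arr 1 (4 * k + 1) /
        intRate S.I (⟨r, hr⟩ : Fin S.m) (⟨j, hj⟩ : Fin S.m)) • dir S.A S.c ⟨r, hr⟩ := by
    have hW0 : (σ.arr 1 (4 * k + 1) : ℝ) ≠ 0 := by exact_mod_cast (hst.den_pos k le_rfl).ne'
    have hR0 : (intRate S.I r j : ℝ) ≠ 0 := by exact_mod_cast hrate.ne'
    have hd : dir S.A S.c ⟨r, hr⟩ =
        ![-((intDetC S.I r : ℝ) * rowB S.I r), (intDetC S.I r : ℝ) * rowA S.I r] := by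
      rw [dir, det2_intObj]; simp [intMat]
    rw [hd]
    unfold pt
    rw [c0, c1, c2, c3, hst.den_eq k le_rfl, hX'def, hY'def, hW'def]
    ext i; fin_cases i
    · simp; field_simp; ring
    · simp; field_simp
  have hpiv : Pivot S.A S.b S.c ⟨r, hr⟩ ⟨j, hj⟩ (pt (σ.arr 1) k) (pt (σ₄.arr 1) (k + 1)) :=
    (pivot_iff_int hst).2 ⟨hrate, hslack, fun i hi => (hB i i.2 hi).2, hpt⟩
  have hI4 : σ₄.arr 0 = S.I := by ext z; simp [hσ₄, hσ₃, hσ₂, hσ₁, hI]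
  clear_value σ₄
  have hst4 : S.Stored (σ₄.arr 1) (k + 1) := by
    refine hst.snoc hg (c3.trans c1.symm) ?_ hpiv ?_
    · rw [c1]; exact mul_pos (hst.den_pos k le_rfl) hrate
    · rw [c0, c1, c2, pow_succ, ← mul_assoc]
      exact ⟨hX'', hY'', hW'⟩
  refine ⟨fun y hy => by rw [State.var_setVar, if_neg (by omega), hvar], _, hpiv, hI4, ?_, hst4,
    rfl⟩
  rw [State.var_setVar, if_pos rfl]

/-- The outcome of an attempted move from `x` along row `r`: the walk is extended by the move, or it
is unchanged because the move is impossible. -/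
def Moved (S : Setup) (k : ℕ) (x : Fin 2 → ℝ) (r : Fin S.m) (τ : State) : Prop :=
  (S.At k x τ ∧ ∀ j x', ¬ Pivot S.A S.b S.c r j x x') ∨
    ∃ j x', Pivot S.A S.b S.c r j x x' ∧ S.At (k + 1) x' τ

theorem runs_moveProg {x : Fin 2 → ℝ} {r : ℕ} (h : S.At k x σ) (hr : r < S.m) (hk : k < S.H)
    (hv : σ.var 6 = r) :
    Runs S.M moveProg σ (S.m * 7 + 17) fun τ => (∀ y, 2 < y → τ.var y = σ.var y) ∧
      S.Moved k x ⟨r, hr⟩ τ := by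
  refine Runs.seq (n₁ := S.m * 7 + 5) (n₂ := 11) ((runs_scanProg h hr hv).mono le_rfl ?_)
  rintro τ ⟨h1, h2, h3, j, hj, h5, h6⟩
  have hτ := h.congr h1 h2
  have h7 : τ.var 6 = r := by rw [h3 6 (by norm_num), hv]
  obtain ⟨hI, hk0, hst, hx⟩ := id hτ
  rw [← h1] at h6
  have e2 : (rateE (.var 6) (.var 2)).eval τ = intRate S.I r j := by
    rw [eval_rateE, hI]; simp only [Expr.eval, h7, h5]
  have e4 : (slackE (.var 2)).eval τ = slackAt S.I (τ.arr 1) k j := by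
    rw [eval_slackE, hI, hk0]; simp only [Expr.eval, h5]
  refine Runs.whenAll (n := 9) (fun hpos => ?_) (by norm_num) fun hneg => ⟨h3, Or.inl ⟨hτ, ?_⟩⟩
  · simp only [List.mem_cons, List.not_mem_nil, or_false, forall_eq_or_imp, forall_eq, e2, e4]
      at hpos
    refine (runs_appendProg hτ hr hj hk h7 h5 hpos.1 hpos.2 h6).mono le_rfl ?_
    rintro υ ⟨h8, x', hp, hx'⟩
    exact ⟨fun y hy => (h8 y hy).trans (h3 y hy), Or.inr ⟨_, x', hp, hx'⟩⟩
  · intro i x' hp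
    apply hneg
    rw [← hx] at hp
    obtain ⟨p1, p2, p3, -⟩ := (pivot_iff_int hst).1 hp
    obtain ⟨q1, -⟩ := h6 i i.2 p1
    simp only [List.mem_cons, List.not_mem_nil, or_false, forall_eq_or_imp, forall_eq, e2, e4]
    refine ⟨q1, ?_⟩
    have h8 := p3 ⟨j, hj⟩ q1
    have h9 := mul_pos p2 q1
    exact pos_of_mul_pos_left (h9.trans_le h8) p1.le

end Setup
end CircuitWalks

namespace CircuitWalks

open RAM

namespace Setup

variable {S : Setup} {σ : State} {f : ℤ → ℤ} {k : ℕ} {x : Fin 2 → ℝ}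

theorem eval_m {τ : State} (h : τ.arr 0 = S.I) :
    (Expr.get 0 (.const 0)).eval τ = S.m := by
  simp [Expr.eval, h, S.I_zero]

theorem m_pos (S : Setup) : 0 < S.m := by
  obtain ⟨-, i, -⟩ := isVertex_iff.1 S.vertex
  exact i.pos

theorem runs_initProg (hI : σ.arr 0 = S.I) :
    Runs S.M initProg σ 9 fun τ => (∀ y, 0 < y → τ.var y = σ.var y) ∧ S.At 0 S.s τ := by
  obtain ⟨hX, hY, hW⟩ := S.start_le
  have hMk := S.V_le (k := 0) (Nat.zero_le _)
  rw [pow_zero, mul_one] at hMk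
  obtain ⟨hd0, hd1⟩ := S.den_pos
  refine Runs.seq (n₁ := 1) (n₂ := 7) (Runs.store (by simp [Expr.eval, hI]; omega) ?_)
  refine Runs.seq (n₁ := 1) (n₂ := 5) (Runs.store (by simp [Expr.eval, hI]; omega) ?_)
  refine Runs.seq (n₁ := 1) (n₂ := 3) (Runs.store (by simp [Expr.eval, hI]; omega) ?_)
  refine Runs.seq (n₁ := 1) (n₂ := 1) (Runs.store (by simp [Expr.eval, hI]; omega) ?_)
  refine Runs.assign (by simp [Expr.eval]) ?_
  simp only [Expr.eval]
  set τ := State.setVar _ 0 0 with hτ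
  have e0 : τ.arr 0 = S.I := by ext z; simp [hτ, hI]
  have c0 : τ.arr 1 0 = S.I 1 * S.I 4 := by simp [hτ, hI]
  have c1 : τ.arr 1 1 = S.I 2 * S.I 4 := by simp [hτ, hI]
  have c2 : τ.arr 1 2 = S.I 3 * S.I 2 := by simp [hτ, hI]
  have c3 : τ.arr 1 3 = S.I 2 * S.I 4 := by simp [hτ, hI]
  have hv : ∀ y, 0 < y → τ.var y = σ.var y := fun y hy => by
    simp [hτ, hy.ne']
  have hv0 : τ.var 0 = 0 := by simp [hτ]
  clear_value τ
  have h0 : ∀ i ≤ 0, i = 0 := fun i hi => Nat.le_zero.1 hi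
  have hpt : pt (τ.arr 1) 0 = S.s := by
    have h2 : (S.I 2 : ℝ) ≠ 0 := by exact_mod_cast hd0.ne'
    have h4 : (S.I 4 : ℝ) ≠ 0 := by exact_mod_cast hd1.ne'
    simp only [pt, Nat.cast_zero, mul_zero, zero_add, c0, c1, c2, c3, Setup.s, Int.cast_mul]
    rw [mul_div_mul_right _ _ h4, mul_comm (S.I 2 : ℝ), mul_div_mul_right _ _ h2]
  refine ⟨hv, e0, by simpa using hv0, ⟨?_, ?_, ?_, hpt, ?_, ?_⟩, hpt⟩
  · intro i hi
    rw [h0 i hi]; simpa [c1] using mul_pos hd0 hd1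
  · intro i hi
    rw [h0 i hi]; simp [c1, c3]
  · intro i hi
    rw [h0 i hi, hpt]; exact (isVertex_iff.1 S.vertex).1
  · intro i hi; omega
  · simpa [c0, c1, c2] using ⟨hX, hY, hW⟩

/-! ### The optimality test -/

/-- The condition that the test checks for the pair of rows `i`, `j`. -/
def PairTest (S : Setup) (f : ℤ → ℤ) (k i j : ℕ) : Prop :=
  0 < 1 - slackAt S.I f k i - slackAt S.I f k j ∧ 0 < intDet S.I i j ∧
    0 < intDetC S.I i + 1 ∧ 0 < 1 - intDetC S.I j

theorem Stored.isMaximalVertex_iff (hf : S.Stored f k) :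
    IsMaximalVertex S.A S.b S.c (pt f k) ↔ ∃ i < S.m, ∃ j < S.m, S.PairTest f k i j := by
  rw [← optTest_iff (hf.mem k le_rfl)]
  have key : ∀ i j : Fin S.m, (slack S.A S.b i (pt f k) = 0 ∧ slack S.A S.b j (pt f k) = 0 ∧
      0 < det2 (S.A i) (S.A j) ∧ 0 ≤ det2 (S.A i) S.c ∧ det2 (S.A j) S.c ≤ 0) ↔
      S.PairTest f k i j := by
    intro i j
    have h1 := hf.slackAt_nonneg i.2
    have h2 := hf.slackAt_nonneg j.2
    simp only [hf.slack_eq_zero_iff, det2_intMat, det2_intObj, Int.cast_pos, Int.cast_nonneg_iff,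
      Int.cast_nonpos, PairTest]
    omega
  constructor
  · rintro ⟨i, j, h⟩
    exact ⟨i, i.2, j, j.2, (key i j).1 h⟩
  · rintro ⟨i, hi, j, hj, h⟩
    exact ⟨⟨i, hi⟩, ⟨j, hj⟩, (key ⟨i, hi⟩ ⟨j, hj⟩).2 h⟩

/-- The invariant of the test that was started in `σ`, when the pairs of rows in `D` are done. -/
def TestInv (S : Setup) (σ : State) (k : ℕ) (D : ℕ → ℕ → Prop) (τ : State) : Prop :=
  τ.arr = σ.arr ∧ (∀ y < 5, τ.var y = σ.var y) ∧
    ((τ.var 5 = 1 ∧ ∃ i < S.m, ∃ j < S.m, S.PairTest (σ.arr 1) k i j) ∨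
      (τ.var 5 = σ.var 5 ∧ ∀ i j, D i j → ¬ S.PairTest (σ.arr 1) k i j))

theorem TestInv.setVar {D E : ℕ → ℕ → Prop} {τ : State} {y : ℕ} {z : ℤ}
    (h : S.TestInv σ k D τ) (hy : 5 < y) (hDE : ∀ i j, E i j → D i j) :
    S.TestInv σ k E (τ.setVar y z) := by
  obtain ⟨h1, h2, h3⟩ := h
  refine ⟨h1, fun w hw => ?_, ?_⟩
  · rw [State.var_setVar, if_neg (by omega), h2 w hw]
  · rw [State.var_setVar, if_neg (by omega)]
    exact h3.imp id fun h => ⟨h.1, fun i j hij => h.2 i j (hDE i j hij)⟩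

theorem runs_testProg (h : S.At k x σ) :
    Runs S.M testProg σ (S.m * (S.m * 8 + 6) + 3) fun τ => τ.arr = σ.arr ∧
      (∀ y < 5, τ.var y = σ.var y) ∧
      ((τ.var 5 = 1 ∧ IsMaximalVertex S.A S.b S.c x) ∨
        (τ.var 5 = σ.var 5 ∧ ¬ IsMaximalVertex S.A S.b S.c x)) := by
  obtain ⟨hI, hk, hst, rfl⟩ := h
  rw [hst.isMaximalVertex_iff]
  have hmM := S.m_le
  refine Runs.count (N := S.m) (n := S.m * 8 + 3) (fun i τ =>
    S.TestInv σ k (fun i' j' => i' < i ∧ j' < S.m) τ ∧ τ.var 8 = i) hmM ⟨?_, by simp⟩ ?_ ?_ ?_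
  · refine TestInv.setVar (D := fun _ _ => False) ⟨rfl, fun _ _ => rfl, Or.inr ⟨rfl, by simp⟩⟩
      (by norm_num) fun i j h => by omega
  · rintro i τ ⟨⟨h1, -⟩, h2⟩
    exact ⟨h2, eval_m (by rw [h1, hI])⟩
  · rintro i τ hi ⟨hτ, h8⟩
    refine Runs.count (N := S.m) (n := 5) (fun j τ =>
      S.TestInv σ k (fun i' j' => i' < i ∧ j' < S.m ∨ i' = i ∧ j' < j) τ ∧ τ.var 8 = i ∧
        τ.var 9 = j) hmM ⟨hτ.setVar (by norm_num) fun _ _ h => by omega, by simpa using h8,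
        by simp⟩ ?_ ?_ ?_
    · rintro j τ ⟨⟨h1, -⟩, -, h2⟩
      exact ⟨h2, eval_m (by rw [h1, hI])⟩
    · rintro j τ hj ⟨hτ, h8, h9⟩
      obtain ⟨h1, h2, h3⟩ := id hτ
      have e1 : (slackE (.var 8)).eval τ = slackAt S.I (σ.arr 1) k i := by
        rw [eval_slackE, h1, hI, h2 0 (by norm_num), hk]; simp only [Expr.eval, h8]
      have e2 : (slackE (.var 9)).eval τ = slackAt S.I (σ.arr 1) k j := by
        rw [eval_slackE, h1, hI, h2 0 (by norm_num), hk]; simp only [Expr.eval, h9]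
      have e3 : (detE (.var 8) (.var 9)).eval τ = intDet S.I i j := by
        rw [eval_detE, h1, hI]; simp only [Expr.eval, h8, h9]
      have e4 : (detCE (.var 8)).eval τ = intDetC S.I i := by
        rw [eval_detCE, h1, hI]; simp only [Expr.eval, h8]
      have e5 : (detCE (.var 9)).eval τ = intDetC S.I j := by
        rw [eval_detCE, h1, hI]; simp only [Expr.eval, h9]
      have hiff : (∀ e ∈ [Expr.sub (.sub (.const 1) (slackE (.var 8))) (slackE (.var 9)),
          detE (.var 8) (.var 9), .add (detCE (.var 8)) (.const 1),
          .sub (.const 1) (detCE (.var 9))], 0 < e.eval τ) ↔ S.PairTest (σ.arr 1) k i j := by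
        simp only [List.mem_cons, List.not_mem_nil, or_false, forall_eq_or_imp, forall_eq,
          Expr.eval, e1, e2, e3, e4, e5, PairTest]
      refine Runs.whenAll (n := 1) (fun hpos => ?_) le_rfl fun hneg => ?_
      · rw [hiff] at hpos
        have := hmM
        refine Runs.assign (by simp only [Expr.eval]; omega)
          ⟨by simpa using h9, TestInv.setVar (D := fun i' j' =>
            i' < i ∧ j' < S.m ∨ i' = i ∧ j' < j + 1) ⟨h1, fun y hy => ?_, ?_⟩ (by norm_num)
            fun _ _ h => h, by simpa using h8, by simp⟩
        · rw [State.var_setVar, if_neg (by omega), h2 y hy]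
        · exact Or.inl ⟨by simp [Expr.eval], i, hi, j, hj, hpos⟩
      · rw [hiff] at hneg
        refine ⟨h9, TestInv.setVar (D := fun i' j' =>
            i' < i ∧ j' < S.m ∨ i' = i ∧ j' < j + 1) ⟨h1, h2, h3.imp id ?_⟩ (by norm_num)
            fun _ _ h => h, by simpa using h8, by simp⟩
        rintro ⟨h4, h5⟩
        refine ⟨h4, fun i' j' hij => ?_⟩
        by_cases hnew : i' = i ∧ j' = j
        · rwa [hnew.1, hnew.2]
        · exact h5 i' j' (by omega)
    · rintro τ ⟨hτ, h8, -⟩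
      exact ⟨h8, hτ.setVar (by norm_num) fun _ _ h => by omega, by simp⟩
  · rintro τ ⟨⟨h1, h2, h3⟩, -⟩
    refine ⟨h1, h2, h3.imp id ?_⟩
    rintro ⟨h4, h5⟩
    refine ⟨h4, ?_⟩
    rintro ⟨i, hi, j, hj, hij⟩
    exact h5 i j ⟨hi, hj⟩ hij

/-! ### Exhaustive search -/

/-- Invariant: the remaining word, read from the current point, leads to the end point of the whole
word. -/
theorem runs_followProg {n : ℕ} (h : S.At k x σ) (hv : σ.var 4 = n)
    (hH : k + (word S.m n).length ≤ S.H) (hn : n ≤ S.M) :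
    Runs S.M followProg σ (n * (S.m * 7 + 22) + 1) fun τ =>
      (τ.var 3 = σ.var 3 ∧ τ.var 5 = σ.var 5) ∧ ∃ l, l ≤ k + (word S.m n).length ∧
        S.At l ((word S.m n).foldl (step S.A S.b S.c) x) τ := by
  have hm := S.m_pos
  refine Runs.loop (n := S.m * 7 + 21) (fun c τ => (τ.var 3 = σ.var 3 ∧ τ.var 5 = σ.var 5) ∧
    ∃ l y n', n' ≤ c ∧ n' ≤ n ∧ τ.var 4 = ((n' : ℕ) : ℤ) ∧
      l + (word S.m n').length ≤ k + (word S.m n).length ∧ S.At l y τ ∧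
      (word S.m n').foldl (step S.A S.b S.c) y = (word S.m n).foldl (step S.A S.b S.c) x)
    ⟨⟨rfl, rfl⟩, k, x, n, le_rfl, le_rfl, hv, le_rfl, h, rfl⟩ ?_ ?_
  · rintro c τ ⟨⟨h3, h5⟩, l, y, n', hc, hn', h4, hl, hat, hw⟩ hpos
    simp only [Expr.eval, h4] at hpos
    obtain ⟨p, rfl⟩ : ∃ p, n' = p + 1 := ⟨n' - 1, by omega⟩
    have hp := Nat.div_le_self p S.m
    rw [word_succ, List.length_cons] at hl
    refine ⟨c - 1, by omega, ?_⟩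
    have e1 : (Expr.sub (.sub (.var 4) (.const 1)) (.mul (.get 0 (.const 0))
        (.div (.sub (.var 4) (.const 1)) (.get 0 (.const 0))))).eval τ = ((p % S.m : ℕ) : ℤ) := by
      have : (Expr.get 0 (.const 0)).eval τ = S.m := eval_m hat.1
      simp only [Expr.eval] at this ⊢
      rw [h4, this]
      push_cast
      rw [add_sub_cancel_right, Int.emod_def]
    have hlt := Nat.mod_lt p hm
    refine (Runs.seq (n₁ := 1) (n₂ := S.m * 7 + 19)
      (Runs.assign (by rw [e1]; have := S.m_le; omega) ?_)).mono (by omega) fun _ h => h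
    rw [e1]
    set τ₁ := τ.setVar 6 ((p % S.m : ℕ) : ℤ) with hτ₁
    have e2 : (Expr.div (.sub (.var 4) (.const 1)) (.get 0 (.const 0))).eval τ₁ =
        ((p / S.m : ℕ) : ℤ) := by
      have : (Expr.get 0 (.const 0)).eval τ₁ = S.m := eval_m hat.1
      simp only [Expr.eval] at this ⊢
      rw [this, hτ₁, State.var_setVar, if_neg (by norm_num), h4]
      push_cast
      rw [add_sub_cancel_right]
    refine (Runs.seq (n₁ := 1) (n₂ := S.m * 7 + 17)
      (Runs.assign (by rw [e2, Int.natAbs_natCast]; exact hp.trans (by omega)) ?_)).mono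
        (by omega) fun _ h => h
    rw [e2]
    set τ₂ := τ₁.setVar 4 ((p / S.m : ℕ) : ℤ) with hτ₂
    have hat₂ : S.At l y τ₂ := hat.congr rfl (by simp [hτ₂, hτ₁])
    refine (runs_moveProg hat₂ hlt (by omega) (by simp [hτ₂, hτ₁])).mono le_rfl ?_
    rintro υ ⟨hv, hmove⟩
    have hstep : ∀ y', step S.A S.b S.c y ((⟨p % S.m, hlt⟩ : Fin S.m) : ℕ) = y' →
        (word S.m (p / S.m)).foldl (step S.A S.b S.c) y' =
          (word S.m n).foldl (step S.A S.b S.c) x := by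
      rintro y' rfl
      rw [← hw, word_succ, List.foldl_cons]
    refine ⟨⟨?_, ?_⟩, ?_⟩
    · rw [hv 3 (by norm_num), ← h3]; simp [hτ₂, hτ₁]
    · rw [hv 5 (by norm_num), ← h5]; simp [hτ₂, hτ₁]
    have h4' : υ.var 4 = ((p / S.m : ℕ) : ℤ) := by
      rw [hv 4 (by norm_num)]; simp [hτ₂]
    rcases hmove with ⟨hat', hno⟩ | ⟨j, y', hpiv, hat'⟩
    · exact ⟨l, y, p / S.m, by omega, by omega, h4', by omega, hat', hstep y (step_eq_self hno)⟩
    · exact ⟨l + 1, y', p / S.m, by omega, by omega, h4', by omega, hat', hstep y' hpiv.step_eq⟩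
  · rintro c τ ⟨h35, l, y, n', hc, hn', h4, hl, hat, hw⟩ hpos
    simp only [Expr.eval, h4] at hpos
    obtain rfl : n' = 0 := by omega
    rw [word_zero, List.foldl_nil] at hw
    exact ⟨h35, l, by omega, hw ▸ hat⟩

/-- The word with number `n` leads to a maximal vertex. -/
def Success (S : Setup) (n : ℕ) : Prop :=
  IsMaximalVertex S.A S.b S.c ((word S.m n).foldl (step S.A S.b S.c) S.s)

/-- The search has found a walk, of at most the length of the first successful word. -/
def Found (S : Setup) (τ : State) : Prop :=
  τ.var 5 = 1 ∧ ∃ n l x, S.At l x τ ∧ IsMaximalVertex S.A S.b S.c x ∧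
    l ≤ (word S.m n).length ∧ ∀ n' < n, ¬ S.Success n'

theorem Found.congr {τ υ : State} (h : S.Found τ) (ha : υ.arr = τ.arr)
    (h0 : υ.var 0 = τ.var 0) (h5 : υ.var 5 = τ.var 5) : S.Found υ := by
  obtain ⟨h, n, l, x, hat, h'⟩ := h
  exact ⟨h5.trans h, n, l, x, hat.congr ha h0, h'⟩

theorem runs_searchProg {K : ℕ} (hI : σ.arr 0 = S.I) (h5 : σ.var 5 = 0)
    (hH : (S.m + 1) ^ K ≤ S.H) :
    Runs S.M (searchProg K) σ ((S.m + 1) ^ K *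
        (((S.m + 1) ^ K * (S.m * 7 + 22) + 1) + (S.m * (S.m * 8 + 6) + 3) + 17) + 3) fun τ =>
      S.Found τ ∨ (τ.arr 0 = S.I ∧ τ.var 5 = 0 ∧ ∀ n < (S.m + 1) ^ K, ¬ S.Success n) := by
  have hN : (S.m + 1) ^ K ≤ S.M := hH.trans S.H_le
  obtain ⟨F, hF⟩ : ∃ F, F = (S.m + 1) ^ K * (S.m * 7 + 22) + 1 := ⟨_, rfl⟩
  obtain ⟨T, hT⟩ : ∃ T, T = S.m * (S.m * 8 + 6) + 3 := ⟨_, rfl⟩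
  rw [← hF, ← hT]
  refine Runs.count (N := (S.m + 1) ^ K) (n := F + T + 14)
    (fun i τ => τ.var 3 = i ∧ τ.arr 0 = S.I ∧
      (S.Found τ ∨ (τ.var 5 = 0 ∧ ∀ n < i, ¬ S.Success n))) hN
    ⟨by simp, hI, Or.inr ⟨by simpa using h5, by simp⟩⟩ ?_ ?_ ?_
  · rintro i τ ⟨h3, hI', -⟩
    refine ⟨h3, ?_⟩
    rw [eval_powE, hI', S.I_zero]; push_cast; rfl
  · rintro i τ hi ⟨h3, hI', h⟩
    refine Runs.whenAll (n := F + T + 13) (fun hpos => ?_) (by omega) fun hneg => ?_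
    · have h50 : τ.var 5 = 0 := by
        rcases h with h | h
        · simp [Expr.eval, h.1] at hpos
        · exact h.1
      obtain ⟨-, hfail⟩ := h.resolve_left fun h => by
        have := h.1
        omega
      refine (Runs.seq (n₁ := 9) (n₂ := F + T + 3) ((runs_initProg hI').mono le_rfl ?_)).mono
          (by omega) fun _ h => h
      rintro τ₁ ⟨hv₁, hat₁⟩
      have e1 : (Expr.var 3).eval τ₁ = i := by rw [Expr.eval, hv₁ 3 (by norm_num), h3]
      refine (Runs.seq (n₁ := 1) (n₂ := F + T + 1) (Runs.assign (by rw [e1]; omega) ?_)).mono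
          (by omega) fun _ h => h
      rw [e1]
      have hlen := length_word_le S.m i
      have hat₁' : S.At 0 S.s (τ₁.setVar 4 i) := hat₁.congr rfl (by simp)
      refine Runs.seq (n₁ := F) (n₂ := T) ((runs_followProg hat₁' (n := i) (by simp)
        (by omega) (by omega)).mono (n₂ := F) (by rw [hF]; gcongr) ?_)
      rintro τ₂ ⟨⟨hv3, hv5⟩, l, hl, hat₂⟩
      rw [zero_add] at hl
      have hv3 : τ₂.var 3 = i := by rw [hv3]; simp [hv₁, h3]
      have hv5 : τ₂.var 5 = 0 := by rw [hv5]; simp [hv₁, h50]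
      refine (runs_testProg hat₂).mono hT.ge ?_
      rintro τ₃ ⟨ha, hv, hres⟩
      refine ⟨(hv 3 (by norm_num)).trans hv3, by simp, ?_, ?_⟩
      · rw [State.arr_setVar, ha]; exact hat₂.1
      rcases hres with ⟨hv5', hmax⟩ | ⟨hv5', hmax⟩
      · left
        exact ⟨by simpa using hv5', i, l, _, hat₂.congr ha (by simpa using hv 0 (by norm_num)),
          hmax, hl, hfail⟩
      · right
        refine ⟨by simpa using hv5'.trans hv5, fun n hn => ?_⟩
        rcases Nat.lt_succ_iff_lt_or_eq.1 hn with hn | rfl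
        exacts [hfail n hn, hmax]
    · refine ⟨h3, by simp, hI', Or.inl ?_⟩
      refine (h.resolve_right fun h => hneg ?_).congr rfl (by simp) (by simp)
      simp [Expr.eval, h.1]
  · rintro τ ⟨-, hI', h⟩
    exact h.imp id fun h => ⟨hI', h⟩

/-! ### The edge walk -/

/-- A walk of length `k` along edges to the point `x` has used up `k` rows: no move along these is
possible from `x` or from any higher point. -/
def UsedUp (S : Setup) (k : ℕ) (x : Fin 2 → ℝ) : Prop :=
  ∃ F : Finset (Fin S.m), F.card = k ∧ ∀ r ∈ F, ∀ y ∈ polyhedron S.A S.b, S.c ⬝ᵥ x ≤ S.c ⬝ᵥ y →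
    slack S.A S.b r y = 0 → ∀ j y', ¬ Pivot S.A S.b S.c r j y y'

theorem UsedUp.le (h : S.UsedUp k x) : k ≤ S.m := by
  obtain ⟨F, rfl, -⟩ := h
  simpa using F.card_le_univ

theorem UsedUp.succ {x' : Fin 2 → ℝ} {r j : Fin S.m} (h : S.UsedUp k x)
    (hx : x ∈ polyhedron S.A S.b) (hr : slack S.A S.b r x = 0) (hp : Pivot S.A S.b S.c r j x x') :
    S.UsedUp (k + 1) x' := by
  obtain ⟨F, hF, h⟩ := h
  have hrF : r ∉ F := fun hrF => h r hrF x hx le_rfl hr j x' hp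
  refine ⟨F.cons r hrF, by rw [Finset.card_cons, hF], fun i hi y hy hxy hiy l y' => ?_⟩
  rcases Finset.mem_cons.1 hi with rfl | hi
  · exact hp.not_pivot_of_le hr hy hxy hiy
  · exact h i hi y hy (hp.dotProduct_lt.le.trans hxy) hiy l y'

/-- The state holds an edge walk of length `k` that ends in `x`. -/
def EdgeAt (S : Setup) (k : ℕ) (x : Fin 2 → ℝ) (τ : State) : Prop :=
  S.At k x τ ∧ IsVertex S.A S.b x ∧ S.UsedUp k x

theorem EdgeAt.setVar {τ : State} (h : S.EdgeAt k x τ) {y : ℕ} (hy : 0 < y) (z : ℤ) :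
    S.EdgeAt k x (τ.setVar y z) :=
  ⟨h.1.congr rfl (by simp [hy.ne]), h.2⟩

/-- Every pass over the rows makes a move unless the current point is maximal, so after `i` passes
the point is maximal or the walk has length at least `i`; the latter is impossible for `i > m`. -/
theorem runs_edgeProg (hI : σ.arr 0 = S.I) :
    Runs S.M edgeProg σ ((S.m + 1) * (S.m * (S.m * 7 + 21) + 6) + 13) fun τ =>
      ∃ l x, S.At l x τ ∧ IsMaximalVertex S.A S.b S.c x ∧ l ≤ S.m := by
  have hmM := S.m_le
  have hmH := S.m_lt
  have hHM := S.H_le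
  refine (Runs.seq (n₁ := 9) (n₂ := (S.m + 1) * (S.m * (S.m * 7 + 21) + 6) + 3)
    ((runs_initProg hI).mono le_rfl ?_)).mono (by omega) fun _ h => h
  rintro τ₀ ⟨-, hat₀⟩
  refine Runs.count (N := S.m + 1) (n := S.m * (S.m * 7 + 21) + 3) (fun i τ => τ.var 7 = i ∧
    ∃ l x, S.EdgeAt l x τ ∧ (IsMaximalVertex S.A S.b S.c x ∨ i ≤ l)) (by omega)
    ⟨by simp, 0, S.s, EdgeAt.setVar ⟨hat₀, S.vertex, ∅, rfl, by simp⟩ (by norm_num) _,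
      Or.inr le_rfl⟩ ?_ ?_ ?_
  · rintro i τ ⟨h7, l, x, ⟨hat, -⟩, -⟩
    exact ⟨h7, by simp [Expr.eval, hat.1, S.I_zero]⟩
  · rintro i τ hi ⟨h7, l, x, hE, hprog⟩
    refine Runs.count (N := S.m) (n := S.m * 7 + 18) (fun r τ => τ.var 6 = r ∧ τ.var 7 = i ∧
      ∃ l x, S.EdgeAt l x τ ∧ (IsMaximalVertex S.A S.b S.c x ∨ i + 1 ≤ l ∨ (i ≤ l ∧
        ∀ q : Fin S.m, (q : ℕ) < r → slack S.A S.b q x = 0 →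
          ∀ j x', ¬ Pivot S.A S.b S.c q j x x'))) hmM
      ⟨by simp, by simpa using h7, l, x, hE.setVar (by norm_num) _,
        hprog.imp id fun h => Or.inr ⟨h, by simp⟩⟩ ?_ ?_ ?_
    · rintro r τ ⟨h6, -, l, x, ⟨hat, -⟩, -⟩
      exact ⟨h6, eval_m hat.1⟩
    · rintro r τ hr ⟨h6, h7, l, x, hE, hprog⟩
      obtain ⟨hat, hvert, hused⟩ := id hE
      have hl := hused.le
      have htight : 0 < (Expr.sub (.const 1) (slackE (.var 6))).eval τ ↔
          slack S.A S.b ⟨r, hr⟩ x = 0 := by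
        obtain ⟨hI', h0, hst, hx⟩ := hat
        have h1 := hst.slackAt_nonneg hr
        have e1 : (slackE (.var 6)).eval τ = slackAt S.I (τ.arr 1) l r := by
          rw [eval_slackE, hI', h0]; simp only [Expr.eval, h6]
        rw [← hx, hst.slack_eq_zero_iff, Expr.eval, e1]
        simp only [Expr.eval]
        omega
      have hnone : (slack S.A S.b ⟨r, hr⟩ x = 0 →
          ∀ j x', ¬ Pivot S.A S.b S.c ⟨r, hr⟩ j x x') →
          (IsMaximalVertex S.A S.b S.c x ∨ i + 1 ≤ l ∨ (i ≤ l ∧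
            ∀ q : Fin S.m, (q : ℕ) < r + 1 → slack S.A S.b q x = 0 →
              ∀ j x', ¬ Pivot S.A S.b S.c q j x x')) := by
        intro hno
        refine hprog.imp id (Or.imp id fun h => ⟨h.1, fun q hq => ?_⟩)
        rcases Nat.lt_succ_iff_lt_or_eq.1 hq with hq | hq
        · exact h.2 q hq
        · obtain rfl : q = ⟨r, hr⟩ := Fin.ext hq
          exact hno
      refine Runs.whenAll (n := S.m * 7 + 17) (fun hpos => ?_) (by omega) fun hneg => ?_
      · simp only [List.mem_singleton, forall_eq, htight] at hpos
        refine (runs_moveProg hat hr (by omega) h6).mono le_rfl ?_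
        rintro υ ⟨hv, hmove⟩
        refine ⟨by rw [hv 6 (by norm_num), h6], by simp, by simp [hv, h7], ?_⟩
        rcases hmove with ⟨hat', hno⟩ | ⟨j, x', hp, hat'⟩
        · exact ⟨l, x, EdgeAt.setVar ⟨hat', hvert, hused⟩ (by norm_num) _, hnone fun _ => hno⟩
        · refine ⟨l + 1, x', EdgeAt.setVar ⟨hat', hp.isVertex hat.mem hpos,
            hused.succ hat.mem hpos hp⟩ (by norm_num) _, Or.inr (Or.inl ?_)⟩
          rcases hprog with h | h | h
          · exact absurd hp (not_pivot_of_isMaximalVertex h)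
          · omega
          · omega
      · simp only [List.mem_singleton, forall_eq, htight] at hneg
        exact ⟨h6, by simp, by simpa using h7, l, x, hE.setVar (by norm_num) _,
          hnone fun h => absurd h hneg⟩
    · rintro τ ⟨-, h7, l, x, hE, hprog⟩
      refine ⟨h7, by simp, l, x, hE.setVar (by norm_num) _, ?_⟩
      rcases hprog with h | h | h
      · exact Or.inl h
      · exact Or.inr h
      · rcases exists_edge_pivot_or_isMaximalVertex S.bounded hE.2.1 with h' | ⟨r, j, x', hr, hp⟩
        · exact Or.inl h'
        · exact absurd hp (h.2 r r.2 hr j x')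
  · rintro τ ⟨-, l, x, ⟨hat, -, hused⟩, hprog⟩
    have := hused.le
    exact ⟨l, x, hat, hprog.resolve_right (by omega), this⟩

/-! ### The algorithm as a whole -/

/-- A bound on the number of steps of the algorithm. -/
def steps (m K : ℕ) : ℕ :=
  (m + 1) ^ K * (((m + 1) ^ K * (m * 7 + 22) + 1) + (m * (m * 8 + 6) + 3) + 17) + 3 +
    ((m + 1) * (m * (m * 7 + 21) + 6) + 13) + 2

theorem runs_mainProg {K : ℕ} (hI : σ.arr 0 = S.I) (h5 : σ.var 5 = 0)
    (hH : (S.m + 1) ^ K ≤ S.H) :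
    Runs S.M (mainProg K) σ (steps S.m K) fun τ =>
      ∃ l x, S.At l x τ ∧ IsMaximalVertex S.A S.b S.c x ∧
        ((∀ n, S.Success n → l ≤ (word S.m n).length) ∨
          (l ≤ S.m ∧ ∀ n < (S.m + 1) ^ K, ¬ S.Success n)) := by
  have hsearch := runs_searchProg hI h5 hH
  have hedge := fun τ hτ => runs_edgeProg (S := S) (σ := τ) hτ
  unfold steps
  have hE : 1 ≤ (S.m + 1) * (S.m * (S.m * 7 + 21) + 6) + 13 := by omega
  generalize (S.m + 1) * (S.m * (S.m * 7 + 21) + 6) + 13 = E at hedge hE ⊢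
  generalize (S.m + 1) ^ K * (((S.m + 1) ^ K * (S.m * 7 + 22) + 1) +
    (S.m * (S.m * 8 + 6) + 3) + 17) + 3 = F at hsearch ⊢
  refine Runs.seq (n₁ := F) (n₂ := E + 1) (hsearch.mono le_rfl ?_)
  intro τ hτ
  refine Runs.whenAll (n := E) (fun hpos => ?_) hE fun hneg => ?_
  · obtain ⟨hI', -, hfail⟩ := hτ.resolve_left fun h => by simp [Expr.eval, h.1] at hpos
    refine (hedge τ hI').mono le_rfl ?_
    rintro υ ⟨l, x, hat, hmax, hl⟩
    exact ⟨l, x, hat, hmax, Or.inr ⟨hl, hfail⟩⟩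
  · obtain ⟨-, n, l, x, hat, hmax, hl, hfail⟩ := hτ.resolve_right fun h => hneg (by
      simp [Expr.eval, h.2.1])
    refine ⟨l, x, hat, hmax, Or.inl fun n' hn' => hl.trans (length_word_mono _ ?_)⟩
    exact not_lt.1 fun h => hfail n' h hn'

end Setup
end CircuitWalks

namespace CircuitWalks

open RAM

/-! ### Invariance under scaling -/

section Scaling

variable {m : ℕ} {A A' : Matrix (Fin m) (Fin 2) ℝ} {b b' : Fin m → ℝ} {c c' : Fin 2 → ℝ}
  {w : Fin m → ℝ} {μ : ℝ}

theorem polyhedron_eq_of_scaled (hw : ∀ i, 0 < w i) (hA : ∀ i l, A' i l = w i * A i l)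
    (hb : ∀ i, b' i = w i * b i) : polyhedron A' b' = polyhedron A b := by
  ext x
  simp only [mem_polyhedron_iff]
  refine forall_congr' fun j => ?_
  have : slack A' b' j x = w j * slack A b j x := by
    simp only [slack, hA, hb]; ring
  rw [this, mul_nonneg_iff_of_pos_left (hw j)]

theorem isCircuit_iff_of_scaled (hw : ∀ i, 0 < w i) (hA : ∀ i l, A' i l = w i * A i l)
    {g : Fin 2 → ℝ} : IsCircuit A' g ↔ IsCircuit A g := by
  simp only [isCircuit_iff]
  refine and_congr_right fun _ => exists_congr fun i => ?_
  have h1 : A' i = w i • A i := by ext l; simp [hA]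
  have h2 : A' i 0 * g 0 + A' i 1 * g 1 = w i * (A i 0 * g 0 + A i 1 * g 1) := by
    rw [hA, hA]; ring
  rw [h1, Ne, smul_eq_zero_iff_right (hw i).ne', ← h1, h2, mul_eq_zero_iff_left (hw i).ne']

theorem isMonotoneWalkToMax_iff_of_scaled (hw : ∀ i, 0 < w i) (hA : ∀ i l, A' i l = w i * A i l)
    (hb : ∀ i, b' i = w i * b i) (hμ : 0 < μ) (hc : c' = μ • c) {s : Fin 2 → ℝ} {k : ℕ}
    {x : Fin (k + 1) → Fin 2 → ℝ} :
    IsMonotoneWalkToMax A' b' s c' k x ↔ IsMonotoneWalkToMax A b s c k x := by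
  simp only [IsMonotoneWalkToMax, IsCircuitWalk, IsCircuitMove, IsMaximalVertex, IsVertex,
    polyhedron_eq_of_scaled hw hA hb, isCircuit_iff_of_scaled hw hA, hc, smul_dotProduct,
    smul_eq_mul, mul_lt_mul_iff_right₀ hμ, mul_le_mul_iff_right₀ hμ]

end Scaling

/-! ### The input -/

theorem getD_flatMap_of_length {α : Type*} {f : α → List ℤ} {n : ℕ} (hf : ∀ a, (f a).length = n)
    (L : List α) (i j : ℕ) (hi : i < L.length) (hj : j < n) :
    (L.flatMap f).getD (n * i + j) 0 = (f L[i]).getD j 0 := by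
  induction L generalizing i with
  | nil => simp at hi
  | cons a L ih =>
    rw [List.flatMap_cons]
    cases i with
    | zero =>
      rw [Nat.mul_zero, Nat.zero_add, List.getD_append _ _ _ _ (by rw [hf]; exact hj)]
      rfl
    | succ i =>
      rw [List.getD_append_right _ _ _ _ (by rw [hf]; nlinarith), hf]
      have : n * (i + 1) + j - n = n * i + j := by rw [Nat.mul_succ]; omega
      rw [this]
      exact ih i (by simpa using hi)

variable {m : ℕ} (A : Matrix (Fin m) (Fin 2) ℚ) (b : Fin m → ℚ) (s c : Fin 2 → ℚ)

/-- The input array. -/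
def inputArr : ℤ → ℤ := (State.ofInput (encodeInput A b s c)).arr 0

theorem inputArr_natCast (n : ℕ) : inputArr A b s c n = (encodeInput A b s c).getD n 0 := by
  simp [inputArr, State.ofInput]

theorem inputArr_row (i : Fin m) :
    inputArr A b s c (9 + 6 * (i : ℤ)) = (A i 0).num ∧
    inputArr A b s c (10 + 6 * (i : ℤ)) = (A i 0).den ∧
    inputArr A b s c (11 + 6 * (i : ℤ)) = (A i 1).num ∧
    inputArr A b s c (12 + 6 * (i : ℤ)) = (A i 1).den ∧
    inputArr A b s c (13 + 6 * (i : ℤ)) = (b i).num ∧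
    inputArr A b s c (14 + 6 * (i : ℤ)) = (b i).den := by
  have key : ∀ j < 6, ∀ z : ℤ, z = ((9 + (6 * (i : ℕ) + j) : ℕ) : ℤ) → inputArr A b s c z =
      (encodeRat (A i 0) ++ encodeRat (A i 1) ++ encodeRat (b i)).getD j 0 := by
    rintro j hj _ rfl
    rw [inputArr_natCast, encodeInput, List.getD_append_right _ _ _ _ (by simp [encodeRat])]
    simp only [encodeRat, List.cons_append, List.nil_append, List.length_cons, List.length_nil]
    rw [Nat.add_sub_cancel_left, getD_flatMap_of_length (n := 6) (fun _ => rfl) _ _ _ (by simp) hj]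
    simp
  refine ⟨key 0 (by norm_num) _ (by push_cast; ring),
    key 1 (by norm_num) _ (by push_cast; ring),
    key 2 (by norm_num) _ (by push_cast; ring),
    key 3 (by norm_num) _ (by push_cast; ring),
    key 4 (by norm_num) _ (by push_cast; ring),
    key 5 (by norm_num) _ (by push_cast; ring)⟩

theorem natAbs_inputArr_lt (z : ℤ) :
    (inputArr A b s c z).natAbs < 2 ^ inputSize (encodeInput A b s c) := by
  simp only [inputArr, State.ofInput, true_and]
  split_ifs
  · by_cases hz : z.toNat < (encodeInput A b s c).length
    · rw [List.getD_eq_getElem _ _ hz]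
      refine (natAbs_lt_two_pow_bits _).trans_le (Nat.pow_le_pow_right (by norm_num) ?_)
      exact (Nat.sub_le _ _).trans
        (List.single_le_sum (by simp) _ (List.mem_map_of_mem (List.getElem_mem hz)))
    · rw [List.getD_eq_default _ _ (not_lt.1 hz)]; simp
  · simp

theorem le_inputSize : m ≤ inputSize (encodeInput A b s c) := by
  have h1 : (encodeInput A b s c).length ≤ inputSize (encodeInput A b s c) := by
    have : ∀ l : List ℤ, l.length ≤ inputSize l := by
      intro l
      induction l with
      | nil => simp
      | cons a l ih =>
        have := one_le_bits a
        simp only [inputSize, List.map_cons, List.sum_cons, List.length_cons] at ih ⊢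
        omega
    exact this _
  have h2 : m ≤ (encodeInput A b s c).length := by
    simp [encodeInput, encodeRat, List.length_flatMap]
    omega
  exact h2.trans h1

/-- A bound on the lengths of all walks that the algorithm follows. -/
def lengthBound (K L : ℕ) : ℕ := (L + 1) ^ K + L + 1

/-- The logarithm of a bound on all numbers that the algorithm handles. -/
def sizeBound (K L : ℕ) : ℕ := 2 * L + (4 + 12 * L) * lengthBound K L

/-- The positive factor by which row `i` is multiplied to make it integral. -/
def rowScale (i : Fin m) : ℝ := (A i 0).den * (A i 1).den * (b i).den

theorem rowScale_pos (i : Fin m) : 0 < rowScale A b i := by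
  have h1 := (A i 0).pos
  have h2 := (A i 1).pos
  have h3 := (b i).pos
  unfold rowScale
  positivity

theorem ratCast_mul_den (q : ℚ) : (q : ℝ) * q.den = q.num := by
  exact_mod_cast Rat.mul_den_eq_num q

theorem intMat_inputArr (i : Fin m) (l : Fin 2) :
    intMat (inputArr A b s c) m i l = rowScale A b i * realMat A i l := by
  obtain ⟨h0, h1, h2, h3, h4, h5⟩ := inputArr_row A b s c i
  fin_cases l
  · simp [intMat, rowA, rowScale, realMat, h0, h3, h5, ← ratCast_mul_den (A i 0)]; ring
  · simp [intMat, rowB, rowScale, realMat, h2, h1, h5, ← ratCast_mul_den (A i 1)]; ring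

theorem intRhs_inputArr (i : Fin m) :
    intRhs (inputArr A b s c) m i = rowScale A b i * realVec b i := by
  obtain ⟨h0, h1, h2, h3, h4, h5⟩ := inputArr_row A b s c i
  simp [intRhs, rowR, rowScale, realVec, h4, h1, h3, ← ratCast_mul_den (b i)]; ring

theorem inputArr_head : inputArr A b s c 0 = m ∧
    (inputArr A b s c 1 = (s 0).num ∧ inputArr A b s c 2 = (s 0).den ∧
      inputArr A b s c 3 = (s 1).num ∧ inputArr A b s c 4 = (s 1).den) ∧
    inputArr A b s c 5 = (c 0).num ∧ inputArr A b s c 6 = (c 0).den ∧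
      inputArr A b s c 7 = (c 1).num ∧ inputArr A b s c 8 = (c 1).den :=
  ⟨inputArr_natCast A b s c 0, ⟨inputArr_natCast A b s c 1, inputArr_natCast A b s c 2,
    inputArr_natCast A b s c 3, inputArr_natCast A b s c 4⟩, inputArr_natCast A b s c 5,
    inputArr_natCast A b s c 6, inputArr_natCast A b s c 7, inputArr_natCast A b s c 8⟩

theorem intObj_inputArr :
    intObj (inputArr A b s c) = ((c 0).den * (c 1).den : ℝ) • realVec c := by
  obtain ⟨-, -, h5, h6, h7, h8⟩ := inputArr_head A b s c
  ext l; fin_cases l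
  · simp [intObj, objA, h5, h8, realVec, ← ratCast_mul_den (c 0)]; ring
  · simp [intObj, objB, h7, h6, realVec, ← ratCast_mul_den (c 1)]; ring

theorem start_inputArr :
    (![(inputArr A b s c 1 : ℝ) / inputArr A b s c 2, (inputArr A b s c 3 : ℝ) /
      inputArr A b s c 4] : Fin 2 → ℝ) = realVec s := by
  obtain ⟨-, ⟨h1, h2, h3, h4⟩, -⟩ := inputArr_head A b s c
  have e : ∀ q : ℚ, (q.num : ℝ) / q.den = q := fun q => by
    rw [← ratCast_mul_den, mul_div_cancel_right₀]; exact_mod_cast q.den_nz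
  ext l; fin_cases l
  · simp [h1, h2, realVec, e]
  · simp [h3, h4, realVec, e]

theorem polyhedron_inputArr :
    polyhedron (intMat (inputArr A b s c) m) (intRhs (inputArr A b s c) m) =
      polyhedron (realMat A) (realVec b) :=
  polyhedron_eq_of_scaled (rowScale_pos A b) (intMat_inputArr A b s c) (intRhs_inputArr A b s c)

theorem two_pow_mul_le {x y : ℤ} {L : ℕ} (hx : x.natAbs < 2 ^ L) (hy : y.natAbs < 2 ^ L) :
    (x * y).natAbs ≤ 2 ^ (2 * L) := by
  rw [Int.natAbs_mul, two_mul, pow_add]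
  exact Nat.mul_le_mul hx.le hy.le

theorem two_pow_mul_mul_le {x y z : ℤ} {L : ℕ} (hx : x.natAbs < 2 ^ L) (hy : y.natAbs < 2 ^ L)
    (hz : z.natAbs < 2 ^ L) : (x * y * z).natAbs ≤ 2 ^ (3 * L) := by
  rw [Int.natAbs_mul, show 3 * L = 2 * L + L by ring, pow_add]
  exact Nat.mul_le_mul (two_pow_mul_le hx hy) hz.le

/-- The bounds for the integer data of an instance. -/
noncomputable def setup (K : ℕ) (hP : IsPolygon (realMat A) (realVec b))
    (hs : IsVertex (realMat A) (realVec b) (realVec s)) : Setup where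
  I := inputArr A b s c
  m := m
  U := 2 ^ (3 * inputSize (encodeInput A b s c))
  V := 2 ^ (2 * inputSize (encodeInput A b s c))
  H := lengthBound K (inputSize (encodeInput A b s c))
  M := 2 ^ sizeBound K (inputSize (encodeInput A b s c))
  I_zero := (inputArr_head A b s c).1
  rowA_le _ _ := two_pow_mul_mul_le (natAbs_inputArr_lt ..) (natAbs_inputArr_lt ..)
    (natAbs_inputArr_lt ..)
  rowB_le _ _ := two_pow_mul_mul_le (natAbs_inputArr_lt ..) (natAbs_inputArr_lt ..)
    (natAbs_inputArr_lt ..)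
  rowR_le _ _ := two_pow_mul_mul_le (natAbs_inputArr_lt ..) (natAbs_inputArr_lt ..)
    (natAbs_inputArr_lt ..)
  objA_le := (two_pow_mul_le (natAbs_inputArr_lt ..) (natAbs_inputArr_lt ..)).trans
    (Nat.pow_le_pow_right (by norm_num) (by omega))
  objB_le := (two_pow_mul_le (natAbs_inputArr_lt ..) (natAbs_inputArr_lt ..)).trans
    (Nat.pow_le_pow_right (by norm_num) (by omega))
  start_le := ⟨two_pow_mul_le (natAbs_inputArr_lt ..) (natAbs_inputArr_lt ..),
    two_pow_mul_le (natAbs_inputArr_lt ..) (natAbs_inputArr_lt ..),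
    two_pow_mul_le (natAbs_inputArr_lt ..) (natAbs_inputArr_lt ..)⟩
  den_pos := by
    obtain ⟨-, ⟨-, h2, -, h4⟩, -⟩ := inputArr_head A b s c
    rw [h2, h4]
    exact ⟨by exact_mod_cast (s 0).pos, by exact_mod_cast (s 1).pos⟩
  U_pos := by positivity
  V_pos := by positivity
  hM := by
    rw [sizeBound, pow_add, pow_mul 2 (4 + 12 * _)]
    refine Nat.mul_le_mul_left _ (Nat.pow_le_pow_left ?_ _)
    rw [← pow_mul, pow_add, show ∀ L, 3 * L * 4 = 12 * L by intro L; ring]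
    exact Nat.mul_le_mul_right _ (by norm_num)
  m_lt := by
    have := le_inputSize A b s c
    unfold lengthBound
    omega
  bounded := by rw [polyhedron_inputArr]; exact hP.1
  vertex := by
    rw [start_inputArr, IsVertex, polyhedron_inputArr]
    exact hs

/-! ### Running time and approximation ratio -/

open Polynomial in
theorem exists_timeBound (K : ℕ) (q : ℕ[X]) : ∃ p : ℕ[X], ∀ L,
    p.eval L = Setup.steps L K * q.eval ((2 ^ sizeBound K L).size + 1) := by
  refine ⟨((X + 1) ^ K * (((X + 1) ^ K * (X * 7 + 22) + 1) + (X * (X * 8 + 6) + 3) + 17) + 3 +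
    ((X + 1) * (X * (X * 7 + 21) + 6) + 13) + 2) *
      q.comp (2 * X + (4 + 12 * X) * ((X + 1) ^ K + X + 1) + 1 + 1), fun L => ?_⟩
  rw [Nat.size_pow]
  simp [Setup.steps, sizeBound, lengthBound, eval_comp]

theorem Setup.steps_mono {K m L : ℕ} (h : m ≤ L) : Setup.steps m K ≤ Setup.steps L K := by
  unfold Setup.steps
  gcongr

/-- The walk in the final state is a monotone circuit walk in the integer system. -/
theorem Setup.At.isMonotoneWalkToMax {S : Setup} {k : ℕ} {x : Fin 2 → ℝ} {σ : State}
    (h : S.At k x σ) (hmax : IsMaximalVertex S.A S.b S.c x) :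
    OutputsWalk σ k (fun i => pt (σ.arr 1) i) ∧
      IsMonotoneWalkToMax S.A S.b S.s S.c k fun i => pt (σ.arr 1) i := by
  obtain ⟨-, hk, hst, rfl⟩ := h
  refine ⟨⟨hk, fun i => ?_⟩, ⟨fun i => hst.mem i (Nat.le_of_lt_succ i.2), fun i => ?_⟩,
    fun i => ?_, hst.start, hmax⟩
  · have h1 := hst.den_pos i (Nat.le_of_lt_succ i.2)
    exact ⟨h1, (hst.den_eq i (Nat.le_of_lt_succ i.2)).symm ▸ h1, rfl, rfl⟩
  · obtain ⟨r, j, hp⟩ := hst.move i i.2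
    exact hp.isCircuitMove (hst.mem i i.2.le)
  · obtain ⟨r, j, hp⟩ := hst.move i i.2
    exact hp.dotProduct_lt

/-- The approximation guarantee, from the two possible outcomes of the algorithm. -/
theorem Setup.le_max_mul {S : Setup} {K k l : ℕ} (hK : 0 < K) {y : Fin (l + 1) → Fin 2 → ℝ}
    (hy : IsMonotoneWalkToMax S.A S.b S.s S.c l y)
    (h : (∀ n, S.Success n → k ≤ (word S.m n).length) ∨
      (k ≤ S.m ∧ ∀ n < (S.m + 1) ^ K, ¬ S.Success n)) :
    (k : ℝ) ≤ max ((S.m : ℝ) / K) 1 * l := by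
  obtain ⟨w, hwl, hwm, hw⟩ := exists_word_of_walk hy
  obtain ⟨n, hn, rfl⟩ := exists_word_eq hwm
  have hsucc : S.Success n := by
    unfold Setup.Success
    rw [hw]
    exact hy.2.2.2
  rcases h with h | ⟨hkm, h⟩
  · have h1 : (k : ℝ) ≤ l := by exact_mod_cast hwl ▸ h n hsucc
    exact h1.trans (le_mul_of_one_le_left (Nat.cast_nonneg l) (le_max_right _ _))
  · have hKl : K ≤ l := by
      by_contra hlt
      refine h n (hn.trans_le ?_) hsucc
      rw [hwl]
      exact Nat.pow_le_pow_right (by omega) (by omega)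
    have hK' : (0 : ℝ) < K := by exact_mod_cast hK
    calc (k : ℝ) ≤ S.m := by exact_mod_cast hkm
      _ = S.m / K * K := by field_simp
      _ ≤ S.m / K * l := by gcongr
      _ ≤ _ := by gcongr; exact le_max_left _ _

end CircuitWalks

theorem mainTheorem10 (K : ℕ) (hK : 0 < K) :
    ∃ (prog : RAM.Prog) (p : Polynomial ℕ),
      ∀ (m : ℕ) (A : Matrix (Fin m) (Fin 2) ℚ) (b : Fin m → ℚ) (s c : Fin 2 → ℚ),
        CircuitWalks.IsPolygon (CircuitWalks.realMat A) (CircuitWalks.realVec b) →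
        CircuitWalks.IsVertex (CircuitWalks.realMat A) (CircuitWalks.realVec b)
          (CircuitWalks.realVec s) →
        ∃ (t : ℕ) (σ : RAM.State) (k : ℕ) (x : Fin (k + 1) → Fin 2 → ℝ) (kmin : ℕ),
          RAM.Exec prog (RAM.State.ofInput (CircuitWalks.encodeInput A b s c)) t σ ∧
          t ≤ p.eval (RAM.inputSize (CircuitWalks.encodeInput A b s c)) ∧
          CircuitWalks.OutputsWalk σ k x ∧
          CircuitWalks.IsMonotoneWalkToMax (CircuitWalks.realMat A) (CircuitWalks.realVec b)
            (CircuitWalks.realVec s) (CircuitWalks.realVec c) k x ∧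
          IsLeast {l : ℕ | ∃ y : Fin (l + 1) → Fin 2 → ℝ,
            CircuitWalks.IsMonotoneWalkToMax (CircuitWalks.realMat A) (CircuitWalks.realVec b)
              (CircuitWalks.realVec s) (CircuitWalks.realVec c) l y} kmin ∧
          (k : ℝ) ≤ max ((m : ℝ) / (K : ℝ)) 1 * (kmin : ℝ) := by
  classical
  obtain ⟨p, hp⟩ := CircuitWalks.exists_timeBound K (CircuitWalks.mainProg K).costP
  refine ⟨CircuitWalks.mainProg K, p, fun m A b s c hP hs => ?_⟩
  let S := CircuitWalks.setup A b s c K hP hs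
  have hmL := CircuitWalks.le_inputSize A b s c
  -- the integer system has the same monotone walks
  have hiff : ∀ {l : ℕ} {y : Fin (l + 1) → Fin 2 → ℝ},
      CircuitWalks.IsMonotoneWalkToMax S.A S.b S.s S.c l y ↔
      CircuitWalks.IsMonotoneWalkToMax (CircuitWalks.realMat A) (CircuitWalks.realVec b)
        (CircuitWalks.realVec s) (CircuitWalks.realVec c) l y := by
    intro l y
    have hs' : S.s = CircuitWalks.realVec s := CircuitWalks.start_inputArr A b s c
    rw [hs']
    have h0 := (c 0).pos
    have h1 := (c 1).pos
    exact CircuitWalks.isMonotoneWalkToMax_iff_of_scaled (CircuitWalks.rowScale_pos A b)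
      (CircuitWalks.intMat_inputArr A b s c) (CircuitWalks.intRhs_inputArr A b s c)
      (by positivity) (CircuitWalks.intObj_inputArr A b s c)
  obtain ⟨σ, n, hn, hexec, k, x, hat, hmax, hres⟩ :=
    CircuitWalks.Setup.runs_mainProg (S := S) (K := K)
      (σ := RAM.State.ofInput (CircuitWalks.encodeInput A b s c)) rfl rfl
      ((Nat.pow_le_pow_left (Nat.succ_le_succ hmL) K).trans
        (Nat.le_add_right_of_le (Nat.le_add_right _ _)))
  obtain ⟨-, t, ht, hexec⟩ := hexec.exists_exec (by
    refine ⟨fun _ => Nat.zero_le _, fun a i => ?_⟩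
    by_cases ha : a = 0
    · subst ha
      refine (CircuitWalks.natAbs_inputArr_lt A b s c i).le.trans
        (Nat.pow_le_pow_right (by norm_num) ?_)
      unfold CircuitWalks.sizeBound
      omega
    · simp [RAM.State.ofInput, ha])
  obtain ⟨hout, hwalk⟩ := hat.isMonotoneWalkToMax hmax
  have hne : ∃ l, ∃ y : Fin (l + 1) → Fin 2 → ℝ,
      CircuitWalks.IsMonotoneWalkToMax (CircuitWalks.realMat A) (CircuitWalks.realVec b)
        (CircuitWalks.realVec s) (CircuitWalks.realVec c) l y := ⟨k, _, hiff.1 hwalk⟩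
  obtain ⟨y, hy⟩ := Nat.find_spec hne
  refine ⟨t, σ, k, _, Nat.find hne, hexec, ht.trans ?_, hout, hiff.1 hwalk,
    ⟨Nat.find_spec hne, fun l hl => Nat.find_min' hne hl⟩,
    CircuitWalks.Setup.le_max_mul hK (hiff.2 hy) hres⟩
  rw [hp]
  exact Nat.mul_le_mul_right _ (hn.trans (CircuitWalks.Setup.steps_mono hmL))
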